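/- Let $(\widetilde M, g, J)$ be a Kähler manifold of real dimension $2m$ with Levi-Civita connection $\widetilde\nabla$, and let $M$ be a connected smooth surface (a $2$-dimensional manifold), immersed in $\widetilde M$ and endowed with the induced metric. Write $T_pM^\perp$ for the normal space of $M$ at $p$, and for a normal vector field $\xi$ along $M$ let $D_X\xi$ be the normal component of $\widetilde\nabla_X\xi$ (the normal connection) and $f\xi$ the normal component of $J\xi$. Let $\sigma(X,Y)$, the normal component of $\widetilde\nabla_XY$ for vector fields $X,Y$ tangent to $M$, be the second fundamental form, and let $H=\tfrac12\operatorname{tr}\sigma$ be the mean curvature vector. Assume that 1. $M$ is totally real: $J\,T_pM\subset T_pM^\perp$ for every $p\in M$; 2. the $f$-structure in the normal bundle is parallel: $D_X(f\xi)=f(D_X\xi)$ for all tangent vector fields $X$ and all normal vector fields $\xi$ (the case $f=0$, in which this is trivial, is included); 3. the mean curvature vector is parallel: $D_XH=0$ for all tangent vector fields $X$. Then $M$ is flat (the curvature tensor of the induced metric vanishes identically) or $M$ is minimal ($H=0$ identically). -/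

import Mathlib

open Bundle Set
open scoped Manifold ContDiff Topology

noncomputable section

namespace TotallyReal

/-! ## Covariant differentiation along a map, and the Levi-Civita connection -/

section Connection

variable {E : Type*} [NormedAddCommGroup E] [NormedSpace ℝ E]
  {N : Type*} [TopologicalSpace N] [ChartedSpace E N]

/-- A field of bilinear forms on the tangent spaces of a manifold `N` modelled on `E`. -/
abbrev FormField (E : Type*) [NormedAddCommGroup E] [NormedSpace ℝ E]
    (N : Type*) [TopologicalSpace N] [ChartedSpace E N] : Type _ :=
  ∀ q : N, TangentSpace 𝓘(ℝ, E) q →L[ℝ] TangentSpace 𝓘(ℝ, E) q →L[ℝ] ℝ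

/-- A vector field on `N`. -/
abbrev VField (E : Type*) [NormedAddCommGroup E] [NormedSpace ℝ E]
    (N : Type*) [TopologicalSpace N] [ChartedSpace E N] : Type _ :=
  ∀ q : N, TangentSpace 𝓘(ℝ, E) q

variable [IsManifold 𝓘(ℝ, E) ∞ N]

/-- Pull-back of a bilinear form by a linear map: `pullForm B L u v = B (L u) (L v)`. -/
def pullForm {F : Type*} [NormedAddCommGroup F] [NormedSpace ℝ F]
    (B : E →L[ℝ] E →L[ℝ] ℝ) (L : F →L[ℝ] E) : F →L[ℝ] F →L[ℝ] ℝ :=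
  B.bilinearComp L L

/-- For a field of bilinear forms `G` on the model space, the covector
`w ↦ (1/2) (∂_u G(v, w) + ∂_v G(u, w) - ∂_w G(u, v))` at the point `y`. -/
def koszulCovector (G : E → E →L[ℝ] E →L[ℝ] ℝ) (y u v : E) : E →L[ℝ] ℝ :=
  (2⁻¹ : ℝ) • (fderiv ℝ (fun z ↦ G z v) y u + fderiv ℝ (fun z ↦ G z u) y v
    - fderiv ℝ (fun z ↦ G z u v) y)

/-- Components of the form field `g` in the preferred chart at `q`, as a function on the model
space: `chartForm g q y (u, v)` is `g` at the point with coordinate `y`, evaluated on the vectors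
with coordinates `u` and `v`. -/
def chartForm (g : FormField E N) (q : N) (y : E) : E →L[ℝ] E →L[ℝ] ℝ :=
  let e := trivializationAt E (TangentSpace 𝓘(ℝ, E) : N → Type _) q
  let q' := (extChartAt 𝓘(ℝ, E) q).symm y
  pullForm (E := E) (F := E) (g q') (e.symmL ℝ q')

/-- The Christoffel symbol of `g` at `q` in the preferred chart at `q` (in which the tangent space
at `q` is the model space): `christoffel g q u v` is the vector `Γ` with
`2 g(Γ, w) = ∂_u g(v, w) + ∂_v g(u, w) - ∂_w g(u, v)` for all `w`. -/
def christoffel (g : FormField E N) (q : N) (u v : TangentSpace 𝓘(ℝ, E) q) :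
    TangentSpace 𝓘(ℝ, E) q :=
  (g q).inverse (koszulCovector (E := E) (chartForm g q) (extChartAt 𝓘(ℝ, E) q q) u v)

variable {F : Type*} [NormedAddCommGroup F] [NormedSpace ℝ F]
  {M : Type*} [TopologicalSpace M] [ChartedSpace F M]

/-- Covariant derivative, with respect to the Levi-Civita connection of `(N, g)`, of a vector field
`s` along the map `φ : M → N`, at `p` in the direction `v`. In the preferred chart of `N` at `φ p`
it is `ds(v) + Γ(dφ(v), s)`. -/
def covAlong (g : FormField E N) (φ : M → N) (s : ∀ p : M, TangentSpace 𝓘(ℝ, E) (φ p))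
    (p : M) (v : TangentSpace 𝓘(ℝ, F) p) : TangentSpace 𝓘(ℝ, E) (φ p) :=
  let e := trivializationAt E (TangentSpace 𝓘(ℝ, E) : N → Type _) (φ p)
  let sCoord : M → E := fun p' ↦ (e ⟨φ p', s p'⟩).2
  let ds : TangentSpace 𝓘(ℝ, E) (φ p) := mfderiv 𝓘(ℝ, F) 𝓘(ℝ, E) sCoord p v
  ds + christoffel g (φ p) (mfderiv 𝓘(ℝ, F) 𝓘(ℝ, E) φ p v) (s p)

/-- Smoothness of a vector field along the map `φ : M → N`. -/
def SmoothAlong (φ : M → N) (s : ∀ p : M, TangentSpace 𝓘(ℝ, E) (φ p)) : Prop :=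
  ContMDiff 𝓘(ℝ, F) (𝓘(ℝ, E).prod 𝓘(ℝ, E)) ∞
    (fun p ↦ (⟨φ p, s p⟩ : TotalSpace E (TangentSpace 𝓘(ℝ, E) : N → Type _)))

/-- Smooth vector fields on `N`. -/
def SmoothField (X : VField E N) : Prop := SmoothAlong (F := E) (fun q : N ↦ q) X

/-- The Levi-Civita connection `∇_v X` at the point `q` of `(N, g)`. -/
def leviCivita (g : FormField E N) (X : VField E N) (q : N) (v : TangentSpace 𝓘(ℝ, E) q) :
    TangentSpace 𝓘(ℝ, E) q :=
  covAlong g (fun q : N ↦ q) X q v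

/-- The curvature `R(X, Y)Z = ∇_X ∇_Y Z - ∇_Y ∇_X Z - ∇_[X, Y] Z`. -/
def curvature (g : FormField E N) (X Y Z : VField E N) (q : N) : TangentSpace 𝓘(ℝ, E) q :=
  leviCivita g (fun q' ↦ leviCivita g Z q' (Y q')) q (X q)
    - leviCivita g (fun q' ↦ leviCivita g Z q' (X q')) q (Y q)
    - leviCivita g Z q (VectorField.mlieBracket 𝓘(ℝ, E) X Y q)

/-- `(N, g)` is flat: its curvature tensor vanishes. -/
def IsFlat (g : FormField E N) : Prop :=
  ∀ X Y Z : VField E N, SmoothField X → SmoothField Y → SmoothField Z →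
    ∀ q, curvature g X Y Z q = 0

end Connection

/-! ## Kähler manifolds -/

/-- A Kähler structure on a smooth manifold `N`: a smooth Riemannian metric `g` and a smooth field
`J` of endomorphisms with `J² = -1`, orthogonal with respect to `g`, and parallel with respect to
the Levi-Civita connection: `∇_v (J X) = J (∇_v X)`. Since the connection is torsion-free, the last
condition contains the integrability of `J`. -/
structure KahlerStructure (E : Type*) [NormedAddCommGroup E] [NormedSpace ℝ E]
    (N : Type*) [TopologicalSpace N] [ChartedSpace E N] [IsManifold 𝓘(ℝ, E) ∞ N] where
  metric : ContMDiffRiemannianMetric 𝓘(ℝ, E) ∞ E (TangentSpace 𝓘(ℝ, E) : N → Type _)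
  J : ∀ q : N, TangentSpace 𝓘(ℝ, E) q →L[ℝ] TangentSpace 𝓘(ℝ, E) q
  smooth_J : ContMDiff 𝓘(ℝ, E) (𝓘(ℝ, E).prod 𝓘(ℝ, E →L[ℝ] E)) ∞
    (fun q ↦ TotalSpace.mk' (E →L[ℝ] E)
      (E := fun q : N ↦ TangentSpace 𝓘(ℝ, E) q →L[ℝ] TangentSpace 𝓘(ℝ, E) q) q (J q))
  J_J : ∀ (q : N) (v : TangentSpace 𝓘(ℝ, E) q), J q (J q v) = -v
  metric_J : ∀ (q : N) (v w : TangentSpace 𝓘(ℝ, E) q),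
    metric.inner q (J q v) (J q w) = metric.inner q v w
  parallel_J : ∀ X : VField E N, SmoothField X → ∀ (q : N) (v : TangentSpace 𝓘(ℝ, E) q),
    leviCivita metric.inner (fun q' ↦ J q' (X q')) q v = J q (leviCivita metric.inner X q v)

/-! ## Submanifolds -/

section Submanifold

variable {E : Type*} [NormedAddCommGroup E] [NormedSpace ℝ E]
  {N : Type*} [TopologicalSpace N] [ChartedSpace E N] [IsManifold 𝓘(ℝ, E) ∞ N]
  {F : Type*} [NormedAddCommGroup F] [NormedSpace ℝ F]
  {M : Type*} [TopologicalSpace M] [ChartedSpace F M]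

/-- The differential of `φ : M → N` at `p`. -/
abbrev differential (E F : Type*) [NormedAddCommGroup E] [NormedSpace ℝ E]
    [NormedAddCommGroup F] [NormedSpace ℝ F]
    {N : Type*} [TopologicalSpace N] [ChartedSpace E N]
    {M : Type*} [TopologicalSpace M] [ChartedSpace F M] (φ : M → N) (p : M) :
    TangentSpace 𝓘(ℝ, F) p →L[ℝ] TangentSpace 𝓘(ℝ, E) (φ p) :=
  mfderiv 𝓘(ℝ, F) 𝓘(ℝ, E) φ p

/-- `φ` is a smooth immersion, i.e. `M` is an (immersed) submanifold of `N` through `φ`. -/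
def IsSmoothImmersion (E F : Type*) [NormedAddCommGroup E] [NormedSpace ℝ E]
    [NormedAddCommGroup F] [NormedSpace ℝ F]
    {N : Type*} [TopologicalSpace N] [ChartedSpace E N]
    {M : Type*} [TopologicalSpace M] [ChartedSpace F M] (φ : M → N) : Prop :=
  ContMDiff 𝓘(ℝ, F) 𝓘(ℝ, E) ∞ φ ∧ ∀ p, Function.Injective (differential E F φ p)

/-- The metric on `M` induced by `φ : M → (N, g)`. -/
def inducedMetric (g : FormField E N) (φ : M → N) : FormField F M :=
  fun p ↦ pullForm (E := E) (F := F) (g (φ p)) (differential E F φ p)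

/-- The tangential component of `u`, as an element of the tangent space of `M`: the vector `t` with
`g(dφ(t), dφ(w)) = g(u, dφ(w))` for all `w`. -/
def tangentPart (F : Type*) [NormedAddCommGroup F] [NormedSpace ℝ F]
    {M : Type*} [TopologicalSpace M] [ChartedSpace F M]
    (g : FormField E N) (φ : M → N) (p : M) (u : TangentSpace 𝓘(ℝ, E) (φ p)) :
    TangentSpace 𝓘(ℝ, F) p :=
  (inducedMetric g φ p).inverse ((g (φ p) u).comp (differential E F φ p))

/-- The normal component of `u`. -/
def normalPart (F : Type*) [NormedAddCommGroup F] [NormedSpace ℝ F]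
    {M : Type*} [TopologicalSpace M] [ChartedSpace F M]
    (g : FormField E N) (φ : M → N) (p : M) (u : TangentSpace 𝓘(ℝ, E) (φ p)) :
    TangentSpace 𝓘(ℝ, E) (φ p) :=
  u - differential E F φ p (tangentPart F g φ p u)

/-- `ξ` is a smooth normal vector field of the submanifold. -/
def IsNormalField (F : Type*) [NormedAddCommGroup F] [NormedSpace ℝ F]
    {M : Type*} [TopologicalSpace M] [ChartedSpace F M]
    (g : FormField E N) (φ : M → N) (ξ : ∀ p : M, TangentSpace 𝓘(ℝ, E) (φ p)) : Prop :=
  SmoothAlong (F := F) φ ξ ∧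
    ∀ (p : M) (w : TangentSpace 𝓘(ℝ, F) p), g (φ p) (ξ p) (differential E F φ p w) = 0

/-- The normal connection: `D_v ξ` is the normal component of the ambient derivative of `ξ`. -/
def normalCov (g : FormField E N) (φ : M → N) (ξ : ∀ p : M, TangentSpace 𝓘(ℝ, E) (φ p))
    (p : M) (v : TangentSpace 𝓘(ℝ, F) p) : TangentSpace 𝓘(ℝ, E) (φ p) :=
  normalPart F g φ p (covAlong g φ ξ p v)

/-- `ξ` is parallel in the normal bundle. -/
def IsNormalParallel (F : Type*) [NormedAddCommGroup F] [NormedSpace ℝ F]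
    {M : Type*} [TopologicalSpace M] [ChartedSpace F M]
    (g : FormField E N) (φ : M → N) (ξ : ∀ p : M, TangentSpace 𝓘(ℝ, E) (φ p)) : Prop :=
  ∀ (p : M) (v : TangentSpace 𝓘(ℝ, F) p), normalCov g φ ξ p v = 0

variable [IsManifold 𝓘(ℝ, F) ∞ M]

/-- The second fundamental form `σ(v, w)` at `p`: the normal component of the ambient derivative in
the direction `v` of `dφ(W)`, where `W` is a vector field on `M`, smooth near `p`, with
`W p = w`. -/
def secondFundamentalForm (g : FormField E N) (φ : M → N) (p : M)
    (v w : TangentSpace 𝓘(ℝ, F) p) : TangentSpace 𝓘(ℝ, E) (φ p) :=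
  normalPart F g φ p
    (covAlong g φ (fun p' ↦ differential E F φ p' (FiberBundle.extend F w p')) p v)

/-- The mean curvature vector `H = (1/n) tr σ`, with `n = dim M`. In a basis `b` of the tangent
space, `tr σ = ∑ i j, g^{ij} σ(b_i, b_j)`, where `∑ j, g^{ij} b_j` is the vector that corresponds
under the metric to the `i`-th coordinate functional. -/
def meanCurvature (F : Type*) [NormedAddCommGroup F] [NormedSpace ℝ F] [FiniteDimensional ℝ F]
    {M : Type*} [TopologicalSpace M] [ChartedSpace F M] [IsManifold 𝓘(ℝ, F) ∞ M]
    (g : FormField E N) (φ : M → N) (p : M) : TangentSpace 𝓘(ℝ, E) (φ p) :=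
  let b := Module.finBasis ℝ F
  ((Module.finrank ℝ F : ℝ)⁻¹) • ∑ i, secondFundamentalForm g φ p (b i)
    ((inducedMetric (F := F) g φ p).inverse (b.coord i).toContinuousLinearMap)

/-- The submanifold is minimal: its mean curvature vector vanishes identically. -/
def IsMinimal (F : Type*) [NormedAddCommGroup F] [NormedSpace ℝ F] [FiniteDimensional ℝ F]
    {M : Type*} [TopologicalSpace M] [ChartedSpace F M] [IsManifold 𝓘(ℝ, F) ∞ M]
    (g : FormField E N) (φ : M → N) : Prop :=
  ∀ p : M, meanCurvature F g φ p = 0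

end Submanifold

/-! ## Submanifolds of Kähler manifolds -/

namespace KahlerStructure

variable {E : Type*} [NormedAddCommGroup E] [NormedSpace ℝ E]
  {N : Type*} [TopologicalSpace N] [ChartedSpace E N] [IsManifold 𝓘(ℝ, E) ∞ N]

/-- The underlying form field of the metric. -/
abbrev g (K : KahlerStructure E N) : FormField E N := K.metric.inner

/-- `M` is totally real: `J` maps the tangent spaces of `M` into the normal spaces. -/
def IsTotallyReal (K : KahlerStructure E N) (F : Type*) [NormedAddCommGroup F] [NormedSpace ℝ F]
    {M : Type*} [TopologicalSpace M] [ChartedSpace F M] (φ : M → N) : Prop :=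
  ∀ (p : M) (v w : TangentSpace 𝓘(ℝ, F) p),
    K.g (φ p) (K.J (φ p) (differential E F φ p v)) (differential E F φ p w) = 0

/-- `f ξ` is the normal component of `J ξ`. -/
def f (K : KahlerStructure E N) (F : Type*) [NormedAddCommGroup F] [NormedSpace ℝ F]
    {M : Type*} [TopologicalSpace M] [ChartedSpace F M] (φ : M → N) (p : M)
    (ξ : TangentSpace 𝓘(ℝ, E) (φ p)) : TangentSpace 𝓘(ℝ, E) (φ p) :=
  normalPart F K.g φ p (K.J (φ p) ξ)

/-- The `f`-structure in the normal bundle is parallel: `D_v (f ξ) = f (D_v ξ)` for all smooth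
normal vector fields `ξ`. -/
def HasParallelF (K : KahlerStructure E N) (F : Type*) [NormedAddCommGroup F] [NormedSpace ℝ F]
    {M : Type*} [TopologicalSpace M] [ChartedSpace F M] (φ : M → N) : Prop :=
  ∀ ξ : (∀ p : M, TangentSpace 𝓘(ℝ, E) (φ p)), IsNormalField F K.g φ ξ →
    ∀ (p : M) (v : TangentSpace 𝓘(ℝ, F) p),
      normalCov K.g φ (fun p' ↦ K.f F φ p' (ξ p')) p v = K.f F φ p (normalCov K.g φ ξ p v)

end KahlerStructure

end TotallyReal

end

/-! The hypothesis on `f` forces `J σ` to be tangent to the surface. To see this, take a tangent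
field `Z` and test the parallelism of `f` on the normal field `ξ = J Z`. Since `J ξ = -Z` is
tangent, `f ξ = 0`, hence `f (D_v ξ) = 0`. Because `J` is parallel, the Gauss formula gives `D_v ξ =
J ∇_v Z + n`, where `n` is the normal part of `J σ(v, Z)`. Applying `J` once more shows that `f (D_v
ξ) = J n`, so `n = 0`. This is `J_gaussForm`.

Consequently `-J H` is a tangent field `X`, and `H = J X`
(`J_differential_tangentPart_meanCurvature`). The Gauss formula then yields `∇̃_v H = J ∇_v X + J
σ(v, X)`, in which the first term is normal because the surface is totally real, and the second is
tangent by the previous paragraph. So `D_v H = J ∇_v X`, and `H` parallel means `X` parallel for the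
induced metric (`parallel_tangentPart_meanCurvature`).

A parallel field on a connected surface has constant length (`isFlat_or_eq_zero`). If the length is
zero, then `H = J X = 0`. Otherwise `X / |X|` is a parallel unit field, which completes to a
parallel orthonormal frame, and the curvature vanishes.

The rest is the coordinate calculus behind these few lines: the connection along a map is metric
(`mvfderiv_metric`), a parallel `J` commutes with it (`covAlong_endomorphism`), and the ambient and
induced connections differ by a symmetric normal form (`covAlong_differential`, `metric_gaussForm`).
Smoothness of `X` is needed as well; it comes from a formula for the covariant derivative in one
fixed chart (`metric_covAlong_chart`). -/

open Bundle Set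
open scoped Manifold ContDiff Topology

noncomputable section

namespace TotallyReal

/-! ## Bilinear forms on the model space -/

section Model

variable {E : Type*} [NormedAddCommGroup E] [NormedSpace ℝ E]
  {F : Type*} [NormedAddCommGroup F] [NormedSpace ℝ F]

/-- Shortcut instance: the search is slow on spaces of bilinear forms. -/
instance instNormedAddCommGroupForm : NormedAddCommGroup (E →L[ℝ] F →L[ℝ] ℝ) :=
  ContinuousLinearMap.toNormedAddCommGroup

instance instNormedSpaceForm : NormedSpace ℝ (E →L[ℝ] F →L[ℝ] ℝ) :=
  ContinuousLinearMap.toNormedSpace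

instance instNormedAddCommGroupFormDeriv {D : Type*} [NormedAddCommGroup D] [NormedSpace ℝ D] :
    NormedAddCommGroup (D →L[ℝ] E →L[ℝ] F →L[ℝ] ℝ) :=
  ContinuousLinearMap.toNormedAddCommGroup

instance instNormedSpaceFormDeriv {D : Type*} [NormedAddCommGroup D] [NormedSpace ℝ D] :
    NormedSpace ℝ (D →L[ℝ] E →L[ℝ] F →L[ℝ] ℝ) :=
  ContinuousLinearMap.toNormedSpace

/-- Definiteness gives injectivity, and in finite dimension the dual has the same dimension.
`christoffel` and `tangentPart` are built on `ContinuousLinearMap.inverse`, which is the default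
value `0` off the invertible maps, so their defining identities rest on this. -/
theorem isInvertible_of_pos [FiniteDimensional ℝ E] {B : E →L[ℝ] E →L[ℝ] ℝ}
    (hB : ∀ v, v ≠ 0 → 0 < B v v) : B.IsInvertible := by
  have hinj : Function.Injective B := by
    rw [injective_iff_map_eq_zero]
    intro v hv
    by_contra hne
    have h := hB v hne
    rw [hv] at h
    simp at h
  have hfin : Module.finrank ℝ E = Module.finrank ℝ (E →L[ℝ] ℝ) := by
    rw [← (LinearMap.toContinuousLinearMap (𝕜 := ℝ) (E := E) (F' := ℝ)).finrank_eq]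
    exact (Subspace.dual_finrank_eq (K := ℝ) (V := E)).symm
  let e : E ≃ₗ[ℝ] (E →L[ℝ] ℝ) :=
    LinearEquiv.ofInjectiveOfFinrankEq (B : E →ₗ[ℝ] (E →L[ℝ] ℝ)) hinj hfin
  refine ⟨e.toContinuousLinearEquiv, ?_⟩
  ext v w
  rfl

theorem apply_inverse_of_isInvertible {B : E →L[ℝ] E →L[ℝ] ℝ} (hB : B.IsInvertible)
    (l : E →L[ℝ] ℝ) : B (B.inverse l) = l := by
  obtain ⟨e, rfl⟩ := hB
  simp

/-- The definition differentiates `G` with slots frozen. Rewriting everything through the single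
derivative `fderiv ℝ G y` makes linearity in every slot visible, and the other Koszul identities
become algebra. -/
theorem koszulCovector_apply {G : E → E →L[ℝ] E →L[ℝ] ℝ} {y : E} (hG : DifferentiableAt ℝ G y)
    (u v w : E) : koszulCovector G y u v w =
      2⁻¹ * (fderiv ℝ G y u v w + fderiv ℝ G y v u w - fderiv ℝ G y w u v) := by
  have h1 : ∀ v u w, fderiv ℝ (fun z ↦ G z v) y u w = fderiv ℝ G y u v w := by
    intro v u w
    have : HasFDerivAt (fun z ↦ G z v) ((fderiv ℝ G y).flip v) y := by
      simpa using hG.hasFDerivAt.clm_apply (hasFDerivAt_const v y)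
    rw [this.fderiv]
    rfl
  have h2 : fderiv ℝ (fun z ↦ G z u v) y w = fderiv ℝ G y w u v := by
    have h3 : HasFDerivAt (fun z ↦ G z u) ((fderiv ℝ G y).flip u) y := by
      simpa using hG.hasFDerivAt.clm_apply (hasFDerivAt_const u y)
    have : HasFDerivAt (fun z ↦ G z u v) (((fderiv ℝ G y).flip u).flip v) y := by
      simpa using h3.clm_apply (hasFDerivAt_const v y)
    rw [this.fderiv]
    rfl
  simp [koszulCovector, h1, h2]

theorem hasFDerivAt_form_apply {G : E → E →L[ℝ] E →L[ℝ] ℝ} {x : E} (hG : DifferentiableAt ℝ G x)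
    (b c : E) :
    HasFDerivAt (fun z ↦ G z b c) (((fderiv ℝ G x).flip b).flip c) x := by
  have h3 : HasFDerivAt (fun z ↦ G z b) ((fderiv ℝ G x).flip b) x := by
    simpa using hG.hasFDerivAt.clm_apply (hasFDerivAt_const b x)
  simpa using h3.clm_apply (hasFDerivAt_const c x)

theorem fderiv_form_symm {G : E → E →L[ℝ] E →L[ℝ] ℝ} {y : E} (hG : DifferentiableAt ℝ G y)
    (hs : ∀ᶠ z in 𝓝 y, ∀ v w, G z v w = G z w v) (u v w : E) :
    fderiv ℝ G y u v w = fderiv ℝ G y u w v := by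
  have h' := (hasFDerivAt_form_apply hG w v).congr_of_eventuallyEq (hs.mono fun z hz ↦ hz v w)
  have := congrArg (fun L : E →L[ℝ] ℝ ↦ L u) ((hasFDerivAt_form_apply hG v w).unique h')
  simpa using this

/-- Coordinate form of the vanishing of torsion: for symmetric `G` the Koszul expression is
symmetric in its first two slots. -/
theorem koszulCovector_comm {G : E → E →L[ℝ] E →L[ℝ] ℝ} {y : E} (hG : DifferentiableAt ℝ G y)
    (hs : ∀ᶠ z in 𝓝 y, ∀ v w, G z v w = G z w v) (u v : E) :
    koszulCovector G y u v = koszulCovector G y v u := by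
  ext w
  rw [koszulCovector_apply hG, koszulCovector_apply hG, fderiv_form_symm hG hs w u v]
  ring

/-- Coordinate form of metric compatibility: symmetrizing in the last two slots cancels all but the
derivative in the direction `u`. -/
theorem koszulCovector_add_koszulCovector {G : E → E →L[ℝ] E →L[ℝ] ℝ} {y : E}
    (hG : DifferentiableAt ℝ G y) (hs : ∀ᶠ z in 𝓝 y, ∀ v w, G z v w = G z w v) (u v w : E) :
    koszulCovector G y u v w + koszulCovector G y u w v = fderiv ℝ G y u v w := by
  rw [koszulCovector_apply hG, koszulCovector_apply hG, fderiv_form_symm hG hs v u w,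
    fderiv_form_symm hG hs w u v, fderiv_form_symm hG hs u w v]
  ring

theorem koszulCovector_add_left {G : E → E →L[ℝ] E →L[ℝ] ℝ} {y : E} (hG : DifferentiableAt ℝ G y)
    (u u' v : E) :
    koszulCovector G y (u + u') v = koszulCovector G y u v + koszulCovector G y u' v := by
  ext w
  simp only [koszulCovector_apply hG, add_apply, map_add]
  ring

theorem koszulCovector_smul_left {G : E → E →L[ℝ] E →L[ℝ] ℝ} {y : E} (hG : DifferentiableAt ℝ G y)
    (c : ℝ) (u v : E) :
    koszulCovector G y (c • u) v = c • koszulCovector G y u v := by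
  ext w
  simp only [koszulCovector_apply hG, smul_apply, map_smul, smul_eq_mul]
  ring

theorem differentiableAt_of_eventuallyEq_pullback {G : E → E →L[ℝ] E →L[ℝ] ℝ}
    {G' : F → F →L[ℝ] F →L[ℝ] ℝ} {Φ : F → E} {x : F} (hΦ : ContDiffAt ℝ 2 Φ x)
    (hG : DifferentiableAt ℝ G (Φ x))
    (hG' : ∀ᶠ z in 𝓝 x, ∀ v w, G' z v w = G (Φ z) (fderiv ℝ Φ z v) (fderiv ℝ Φ z w)) :
    DifferentiableAt ℝ G' x := by
  have hΦ1 : DifferentiableAt ℝ Φ x := hΦ.differentiableAt (by norm_num)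
  have hΦ2 : DifferentiableAt ℝ (fderiv ℝ Φ) x :=
    (hΦ.fderiv_right (m := 1) (by norm_num)).differentiableAt (by norm_num)
  have hGΦ : DifferentiableAt ℝ (fun z ↦ G (Φ z)) x :=
    DifferentiableAt.comp (g := G) (f := Φ) x hG hΦ1
  have h1 : DifferentiableAt ℝ (fun z ↦ (G (Φ z)).comp (fderiv ℝ Φ z)) x := hGΦ.clm_comp hΦ2
  have h2 : DifferentiableAt ℝ (fun z ↦ (((G (Φ z)).comp (fderiv ℝ Φ z)).flip).comp
      (fderiv ℝ Φ z)) x :=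
    (DifferentiableAt.comp x (ContinuousLinearMap.flipₗᵢ ℝ F E ℝ).differentiableAt h1 :
      DifferentiableAt ℝ (fun z ↦ ((G (Φ z)).comp (fderiv ℝ Φ z)).flip) x).clm_comp hΦ2
  have h3 : DifferentiableAt ℝ
      (fun z ↦ (G (Φ z)).bilinearComp (fderiv ℝ Φ z) (fderiv ℝ Φ z)) x :=
    DifferentiableAt.comp x (ContinuousLinearMap.flipₗᵢ ℝ F F ℝ).differentiableAt h2
  exact h3.congr_of_eventuallyEq (hG'.mono fun z hz ↦ by ext a b; exact hz a b)

/-- Transformation law of the Koszul covector under pull-back by a map of class `C²`. -/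
theorem koszulCovector_pullback {G : E → E →L[ℝ] E →L[ℝ] ℝ} {G' : F → F →L[ℝ] F →L[ℝ] ℝ}
    {Φ : F → E} {x : F} (hΦ : ContDiffAt ℝ 2 Φ x) (hG : DifferentiableAt ℝ G (Φ x))
    (hs : ∀ v w, G (Φ x) v w = G (Φ x) w v)
    (hG' : ∀ᶠ z in 𝓝 x, ∀ v w, G' z v w = G (Φ z) (fderiv ℝ Φ z v) (fderiv ℝ Φ z w))
    (u v w : F) :
    koszulCovector G' x u v w =
      koszulCovector G (Φ x) (fderiv ℝ Φ x u) (fderiv ℝ Φ x v) (fderiv ℝ Φ x w)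
        + G (Φ x) (fderiv ℝ (fderiv ℝ Φ) x u v) (fderiv ℝ Φ x w) := by
  have hΦ1 : DifferentiableAt ℝ Φ x := hΦ.differentiableAt (by norm_num)
  have hΦ2 : DifferentiableAt ℝ (fderiv ℝ Φ) x :=
    (hΦ.fderiv_right (m := 1) (by norm_num)).differentiableAt (by norm_num)
  have hsymm : ∀ a b, fderiv ℝ (fderiv ℝ Φ) x a b = fderiv ℝ (fderiv ℝ Φ) x b a :=
    hΦ.isSymmSndFDerivAt (by simp)
  have hGΦ : HasFDerivAt (fun z ↦ G (Φ z)) ((fderiv ℝ G (Φ x)).comp (fderiv ℝ Φ x)) x :=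
    HasFDerivAt.comp (g := G) (f := Φ) x hG.hasFDerivAt hΦ1.hasFDerivAt
  have hG'd := differentiableAt_of_eventuallyEq_pullback hΦ hG hG'
  -- Product rule for `G (Φ z) (DΦ b) (DΦ c)`: one term from the form and one Hessian term from each
  -- slot.
  have hd : ∀ a b c, fderiv ℝ G' x a b c =
      fderiv ℝ G (Φ x) (fderiv ℝ Φ x a) (fderiv ℝ Φ x b) (fderiv ℝ Φ x c)
      + G (Φ x) (fderiv ℝ (fderiv ℝ Φ) x a b) (fderiv ℝ Φ x c)
      + G (Φ x) (fderiv ℝ Φ x b) (fderiv ℝ (fderiv ℝ Φ) x a c) := by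
    intro a b c
    have hb := hΦ2.hasFDerivAt.clm_apply (hasFDerivAt_const b x)
    have hc := hΦ2.hasFDerivAt.clm_apply (hasFDerivAt_const c x)
    have h2 := (hGΦ.clm_apply hb).clm_apply hc
    have := congrArg (fun L : F →L[ℝ] ℝ ↦ L a) ((hasFDerivAt_form_apply hG'd b c).unique
      (h2.congr_of_eventuallyEq (hG'.mono fun z hz ↦ hz b c)))
    simp at this
    linarith
  -- Of the six Hessian terms, four cancel by symmetry of the Hessian and of `G`; the two copies of
  -- `G (D²Φ u v) (DΦ w)` absorb the factor `1/2`.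
  rw [koszulCovector_apply hG'd, koszulCovector_apply hG, hd, hd, hd, hsymm v u, hsymm w u,
    hsymm w v, hs (fderiv ℝ Φ x v) (fderiv ℝ (fderiv ℝ Φ) x u w),
    hs (fderiv ℝ Φ x u) (fderiv ℝ (fderiv ℝ Φ) x v w)]
  ring

end Model

/-! ## Reading vectors and functions in charts -/

section Charts

variable {E : Type*} [NormedAddCommGroup E] [NormedSpace ℝ E]
  {N : Type*} [TopologicalSpace N] [ChartedSpace E N]
  {F : Type*} [NormedAddCommGroup F] [NormedSpace ℝ F]
  {M : Type*} [TopologicalSpace M] [ChartedSpace F M]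
  {V : Type*} [NormedAddCommGroup V] [NormedSpace ℝ V]

/-- Together with its converse `mvfderiv_of_hasFDerivAt`, this moves derivatives at `p` to ordinary
calculus in the preferred chart at `p`. There is no boundary, so derivatives within the range of the
model are full derivatives. -/
theorem hasFDerivAt_comp_symm {f : M → V} {p : M} (hf : MDifferentiableAt 𝓘(ℝ, F) 𝓘(ℝ, V) f p) :
    HasFDerivAt (fun x ↦ f ((extChartAt 𝓘(ℝ, F) p).symm x))
      (mvfderiv 𝓘(ℝ, F) f p : F →L[ℝ] V) (extChartAt 𝓘(ℝ, F) p p) := by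
  have h := hf.hasMFDerivAt.2
  simp only [writtenInExtChartAt, extChartAt_model_space_eq_id, modelWithCornersSelf_coe,
    range_id] at h
  exact hasFDerivWithinAt_univ.1 h

theorem mvfderiv_of_hasFDerivAt {f : M → V} {p : M} (hf : ContinuousAt f p) {L : F →L[ℝ] V}
    (h : HasFDerivAt (fun x ↦ f ((extChartAt 𝓘(ℝ, F) p).symm x)) L (extChartAt 𝓘(ℝ, F) p p)) :
    MDifferentiableAt 𝓘(ℝ, F) 𝓘(ℝ, V) f p ∧ (mvfderiv 𝓘(ℝ, F) f p : F →L[ℝ] V) = L := by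
  have h' : HasMFDerivAt 𝓘(ℝ, F) 𝓘(ℝ, V) f p L := by
    refine ⟨hf, ?_⟩
    simp only [writtenInExtChartAt, extChartAt_model_space_eq_id, modelWithCornersSelf_coe,
      range_id]
    exact hasFDerivWithinAt_univ.2 h
  exact ⟨h'.mdifferentiableAt, h'.mfderiv⟩

theorem hasFDerivAt_chart_comp_symm {φ : M → N} {p : M}
    (hφ : MDifferentiableAt 𝓘(ℝ, F) 𝓘(ℝ, E) φ p) :
    HasFDerivAt (fun x ↦ extChartAt 𝓘(ℝ, E) (φ p) (φ ((extChartAt 𝓘(ℝ, F) p).symm x)))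
      (differential E F φ p : F →L[ℝ] E) (extChartAt 𝓘(ℝ, F) p p) := by
  have h := hφ.hasMFDerivAt.2
  simp only [writtenInExtChartAt, modelWithCornersSelf_coe,
    range_id] at h
  exact hasFDerivWithinAt_univ.1 h

theorem tendsto_extChartAt_symm (p : M) :
    Filter.Tendsto (extChartAt 𝓘(ℝ, F) p).symm (𝓝 (extChartAt 𝓘(ℝ, F) p p)) (𝓝 p) := by
  have h := continuousAt_extChartAt_symm (I := 𝓘(ℝ, F)) p
  rwa [ContinuousAt, extChartAt_to_inv] at h

variable [IsManifold 𝓘(ℝ, E) ∞ N]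

/-- The coordinates of a tangent vector at `q` in the preferred chart at `q₀`. -/
def coord (q₀ : N) {q : N} (u : TangentSpace 𝓘(ℝ, E) q) : E :=
  ((trivializationAt E (TangentSpace 𝓘(ℝ, E) : N → Type _) q₀) ⟨q, u⟩).2

/-- The tangent vector at `q` with given coordinates in the preferred chart at `q₀`. -/
def ofCoord (q₀ q : N) (a : E) : TangentSpace 𝓘(ℝ, E) q :=
  (trivializationAt E (TangentSpace 𝓘(ℝ, E) : N → Type _) q₀).symmL ℝ q a

theorem mem_baseSet_iff {q₀ q : N} :
    q ∈ (trivializationAt E (TangentSpace 𝓘(ℝ, E) : N → Type _) q₀).baseSet ↔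
      q ∈ (extChartAt 𝓘(ℝ, E) q₀).source := by
  rw [TangentBundle.trivializationAt_baseSet, extChartAt_source]

theorem coord_eq_continuousLinearMapAt {q₀ q : N} (hq : q ∈ (extChartAt 𝓘(ℝ, E) q₀).source)
    (u : TangentSpace 𝓘(ℝ, E) q) :
    coord q₀ u = (trivializationAt E (TangentSpace 𝓘(ℝ, E) : N → Type _)
      q₀).continuousLinearMapAt ℝ q u := by
  rw [Bundle.Trivialization.continuousLinearMapAt_apply,
    Bundle.Trivialization.linearMapAt_apply, if_pos (mem_baseSet_iff.2 hq)]
  rfl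

theorem coord_eq_mfderiv {q₀ q : N} (hq : q ∈ (extChartAt 𝓘(ℝ, E) q₀).source)
    (u : TangentSpace 𝓘(ℝ, E) q) :
    coord q₀ u = mvfderiv 𝓘(ℝ, E) (extChartAt 𝓘(ℝ, E) q₀) q u := by
  rw [coord_eq_continuousLinearMapAt hq,
    TangentBundle.continuousLinearMapAt_trivializationAt (by rwa [extChartAt_source] at hq)]
  rfl

theorem coord_ofCoord {q₀ q : N} (hq : q ∈ (extChartAt 𝓘(ℝ, E) q₀).source) (a : E) :
    coord q₀ (ofCoord q₀ q a) = a := by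
  rw [coord_eq_continuousLinearMapAt hq]
  exact Bundle.Trivialization.continuousLinearMapAt_symmL _ (mem_baseSet_iff.2 hq) a

theorem ofCoord_coord {q₀ q : N} (hq : q ∈ (extChartAt 𝓘(ℝ, E) q₀).source)
    (u : TangentSpace 𝓘(ℝ, E) q) : ofCoord q₀ q (coord q₀ u) = u := by
  rw [coord_eq_continuousLinearMapAt hq]
  exact Bundle.Trivialization.symmL_continuousLinearMapAt _ (mem_baseSet_iff.2 hq) u

/-- The tangent space at `q` is identified with the model space through the preferred chart at `q`,
whose derivative there is the identity. This is why `covAlong` may add coordinate derivatives to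
Christoffel symbols without conversion. -/
theorem coord_self {q : N} (u : TangentSpace 𝓘(ℝ, E) q) : coord q u = u := by
  rw [coord_eq_mfderiv (mem_extChartAt_source q)]
  exact congrArg (fun L : E →L[ℝ] E ↦ L u) (mfderiv_extChartAt_self (I := 𝓘(ℝ, E)) (x := q))

theorem coord_add {q₀ q : N} (hq : q ∈ (extChartAt 𝓘(ℝ, E) q₀).source)
    (u w : TangentSpace 𝓘(ℝ, E) q) : coord q₀ (u + w) = coord q₀ u + coord q₀ w := by
  simp only [coord_eq_continuousLinearMapAt hq, map_add]

theorem coord_smul {q₀ q : N} (hq : q ∈ (extChartAt 𝓘(ℝ, E) q₀).source) (c : ℝ)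
    (u : TangentSpace 𝓘(ℝ, E) q) : coord q₀ (c • u) = c • coord q₀ u := by
  simp only [coord_eq_continuousLinearMapAt hq, map_smul]

theorem chartForm_apply (g : FormField E N) (q₀ : N) (y a b : E) :
    chartForm g q₀ y a b = g ((extChartAt 𝓘(ℝ, E) q₀).symm y)
      (ofCoord q₀ ((extChartAt 𝓘(ℝ, E) q₀).symm y) a)
      (ofCoord q₀ ((extChartAt 𝓘(ℝ, E) q₀).symm y) b) :=
  rfl

theorem chartForm_coord (g : FormField E N) {q₀ q : N}
    (hq : q ∈ (extChartAt 𝓘(ℝ, E) q₀).source) (u w : TangentSpace 𝓘(ℝ, E) q) :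
    chartForm g q₀ (extChartAt 𝓘(ℝ, E) q₀ q) (coord q₀ u) (coord q₀ w) = g q u w := by
  -- The types of the vectors depend on the base point, so the round trip through the chart is
  -- replaced by a variable point before substituting.
  have key : ∀ q', q' = q → g q' (ofCoord q₀ q' (coord q₀ u)) (ofCoord q₀ q' (coord q₀ w)) =
      g q u w := by
    rintro q' rfl
    rw [ofCoord_coord hq, ofCoord_coord hq]
  exact key _ ((extChartAt 𝓘(ℝ, E) q₀).left_inv hq)

theorem chartForm_self (g : FormField E N) (q : N) (u w : TangentSpace 𝓘(ℝ, E) q) :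
    chartForm g q (extChartAt 𝓘(ℝ, E) q q) u w = g q u w := by
  have h := chartForm_coord g (mem_extChartAt_source (I := 𝓘(ℝ, E)) q) u w
  rwa [coord_self, coord_self] at h

/-- The expression in charts of the image of a tangent vector by a differential. -/
theorem coord_differential {N' : Type*} {E' : Type*} [NormedAddCommGroup E'] [NormedSpace ℝ E']
    [TopologicalSpace N'] [ChartedSpace E' N'] [IsManifold 𝓘(ℝ, E') ∞ N'] {Φ : N → N'} {q₀ q : N}
    {q₁ : N'} (hq : q ∈ (extChartAt 𝓘(ℝ, E) q₀).source)
    (hq' : Φ q ∈ (extChartAt 𝓘(ℝ, E') q₁).source)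
    (hΦ : MDifferentiableAt 𝓘(ℝ, E) 𝓘(ℝ, E') Φ q) (u : TangentSpace 𝓘(ℝ, E) q) :
    coord q₁ (differential E' E Φ q u) =
      fderiv ℝ (fun x ↦ extChartAt 𝓘(ℝ, E') q₁ (Φ ((extChartAt 𝓘(ℝ, E) q₀).symm x)))
        (extChartAt 𝓘(ℝ, E) q₀ q) (coord q₀ u) := by
  have hc : MDifferentiableAt 𝓘(ℝ, E) 𝓘(ℝ, E) (extChartAt 𝓘(ℝ, E) q₀) q :=
    mdifferentiableAt_extChartAt (by rwa [extChartAt_source] at hq)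
  have hc' : MDifferentiableAt 𝓘(ℝ, E') 𝓘(ℝ, E') (extChartAt 𝓘(ℝ, E') q₁) (Φ q) :=
    mdifferentiableAt_extChartAt (by rwa [extChartAt_source] at hq')
  have hs : MDifferentiableAt 𝓘(ℝ, E) 𝓘(ℝ, E) (extChartAt 𝓘(ℝ, E) q₀).symm
      (extChartAt 𝓘(ℝ, E) q₀ q) := by
    have := mdifferentiableWithinAt_extChartAt_symm (I := 𝓘(ℝ, E)) (x := q₀)
      ((extChartAt 𝓘(ℝ, E) q₀).map_source hq)
    rwa [modelWithCornersSelf_coe, range_id, mdifferentiableWithinAt_univ] at this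
  have hinv : (extChartAt 𝓘(ℝ, E) q₀).symm (extChartAt 𝓘(ℝ, E) q₀ q) = q :=
    (extChartAt 𝓘(ℝ, E) q₀).left_inv hq
  set Φc : E → E' := fun x ↦ extChartAt 𝓘(ℝ, E') q₁ (Φ ((extChartAt 𝓘(ℝ, E) q₀).symm x))
    with hΦc
  have hΦs : MDifferentiableAt 𝓘(ℝ, E) 𝓘(ℝ, E') (fun x ↦ Φ ((extChartAt 𝓘(ℝ, E) q₀).symm x))
      (extChartAt 𝓘(ℝ, E) q₀ q) :=
    MDifferentiableAt.comp (I' := 𝓘(ℝ, E)) (g := Φ) (extChartAt 𝓘(ℝ, E) q₀ q)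
      (by rwa [hinv]) hs
  have hΦd : MDifferentiableAt 𝓘(ℝ, E) 𝓘(ℝ, E') Φc (extChartAt 𝓘(ℝ, E) q₀ q) :=
    MDifferentiableAt.comp (I' := 𝓘(ℝ, E')) (g := extChartAt 𝓘(ℝ, E') q₁)
      (extChartAt 𝓘(ℝ, E) q₀ q) (by rwa [hinv]) hΦs
  -- The chart of the image is differentiated along `Φ` in two ways, directly and through the
  -- coordinate expression of `Φ`; uniqueness of the derivative equates the results.
  have h1 : HasMFDerivAt 𝓘(ℝ, E) 𝓘(ℝ, E') (fun z ↦ extChartAt 𝓘(ℝ, E') q₁ (Φ z)) q _ :=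
    HasMFDerivAt.comp q hc'.hasMFDerivAt hΦ.hasMFDerivAt
  have h2 : HasMFDerivAt 𝓘(ℝ, E) 𝓘(ℝ, E') (fun z ↦ Φc (extChartAt 𝓘(ℝ, E) q₀ z)) q _ :=
    HasMFDerivAt.comp (g := Φc) (f := extChartAt 𝓘(ℝ, E) q₀) q hΦd.hasMFDerivAt hc.hasMFDerivAt
  have heq : (fun z ↦ Φc (extChartAt 𝓘(ℝ, E) q₀ z)) =ᶠ[𝓝 q]
      (fun z ↦ extChartAt 𝓘(ℝ, E') q₁ (Φ z)) := by
    filter_upwards [extChartAt_source_mem_nhds' (I := 𝓘(ℝ, E)) hq] with z hz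
    simp only [hΦc, (extChartAt 𝓘(ℝ, E) q₀).left_inv hz]
  have h3 := hasMFDerivAt_unique (h1.congr_of_eventuallyEq heq) h2
  have h4 := congrArg (fun L : E →L[ℝ] E' ↦ L u) h3
  rw [coord_eq_mfderiv hq', coord_eq_mfderiv hq]
  refine h4.trans ?_
  rw [mfderiv_eq_fderiv]
  rfl

end Charts

/-! ## Calculus of the covariant derivative along a map -/

section CovAlong

variable {E : Type*} [NormedAddCommGroup E] [NormedSpace ℝ E]
  {N : Type*} [TopologicalSpace N] [ChartedSpace E N] [IsManifold 𝓘(ℝ, E) ∞ N]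
  {F : Type*} [NormedAddCommGroup F] [NormedSpace ℝ F]
  {M : Type*} [TopologicalSpace M] [ChartedSpace F M]

/-- The form `g q` as a form on the model space. -/
def formAt (g : FormField E N) (q : N) : E →L[ℝ] E →L[ℝ] ℝ := g q

/-- `g` is symmetric, and nondegenerate and differentiable at `q`. -/
structure IsRegularAt (g : FormField E N) (q : N) : Prop where
  symm : ∀ (q' : N) (v w : TangentSpace 𝓘(ℝ, E) q'), g q' v w = g q' w v
  invertible : (formAt g q).IsInvertible
  differentiableAt : DifferentiableAt ℝ (chartForm g q) (extChartAt 𝓘(ℝ, E) q q)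

/-- Differentiability at a point of a vector field along a map. -/
def DiffAlongAt (φ : M → N) (s : ∀ p : M, TangentSpace 𝓘(ℝ, E) (φ p)) (p : M) : Prop :=
  MDifferentiableAt 𝓘(ℝ, F) (𝓘(ℝ, E).prod 𝓘(ℝ, E))
    (fun p ↦ (⟨φ p, s p⟩ : TotalSpace E (TangentSpace 𝓘(ℝ, E) : N → Type _))) p

theorem diffAlongAt_iff {φ : M → N} {s : ∀ p : M, TangentSpace 𝓘(ℝ, E) (φ p)} {p : M} :
    DiffAlongAt (F := F) φ s p ↔ MDifferentiableAt 𝓘(ℝ, F) 𝓘(ℝ, E) φ p ∧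
      MDifferentiableAt 𝓘(ℝ, F) 𝓘(ℝ, E) (fun p' ↦ coord (φ p) (s p')) p :=
  mdifferentiableAt_totalSpace _ _

/-- The derivative of the coordinates of a vector field along a map. -/
def derivCoord (φ : M → N) (s : ∀ p : M, TangentSpace 𝓘(ℝ, E) (φ p)) (p : M)
    (v : TangentSpace 𝓘(ℝ, F) p) : TangentSpace 𝓘(ℝ, E) (φ p) :=
  mvfderiv 𝓘(ℝ, F) (fun p' ↦ coord (φ p) (s p')) p v

theorem covAlong_eq (g : FormField E N) (φ : M → N) (s : ∀ p : M, TangentSpace 𝓘(ℝ, E) (φ p))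
    (p : M) (v : TangentSpace 𝓘(ℝ, F) p) :
    covAlong g φ s p v =
      derivCoord φ s p v + christoffel g (φ p) (differential E F φ p v) (s p) :=
  rfl

theorem chartForm_symm {g : FormField E N}
    (hg : ∀ (q' : N) (v w : TangentSpace 𝓘(ℝ, E) q'), g q' v w = g q' w v) (q : N) (y a b : E) :
    chartForm g q y a b = chartForm g q y b a := by
  rw [chartForm_apply, chartForm_apply]
  exact hg _ _ _

/-! ### Algebra of the Christoffel symbols -/

section Christoffel

variable {g : FormField E N} {q : N}

theorem christoffel_eq (g : FormField E N) (q : N) (u v : E) :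
    christoffel g q u v =
      (formAt g q).inverse (koszulCovector (chartForm g q) (extChartAt 𝓘(ℝ, E) q q) u v) :=
  rfl

theorem metric_christoffel (hg : IsRegularAt g q) (u v w : TangentSpace 𝓘(ℝ, E) q) :
    g q (christoffel g q u v) w =
      koszulCovector (E := E) (chartForm g q) (extChartAt 𝓘(ℝ, E) q q) u v w :=
  congrArg (fun L : E →L[ℝ] ℝ ↦ L w) (apply_inverse_of_isInvertible hg.invertible _)

theorem christoffel_comm (hg : IsRegularAt g q) (u v : TangentSpace 𝓘(ℝ, E) q) :
    christoffel g q u v = christoffel g q v u :=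
  congrArg (formAt g q).inverse (koszulCovector_comm hg.differentiableAt
    (Filter.Eventually.of_forall fun z ↦ chartForm_symm hg.symm q z) u v)

theorem christoffel_add_left (hg : IsRegularAt g q) (u u' v : TangentSpace 𝓘(ℝ, E) q) :
    christoffel g q (u + u') v = christoffel g q u v + christoffel g q u' v :=
  (congrArg (formAt g q).inverse (koszulCovector_add_left hg.differentiableAt u u' v)).trans
    (map_add _ _ _)

theorem christoffel_smul_left (hg : IsRegularAt g q) (c : ℝ) (u v : TangentSpace 𝓘(ℝ, E) q) :
    christoffel g q (c • u) v = c • christoffel g q u v :=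
  (congrArg (formAt g q).inverse (koszulCovector_smul_left hg.differentiableAt c u v)).trans
    (map_smul _ _ _)

theorem christoffel_add_right (hg : IsRegularAt g q) (u v v' : TangentSpace 𝓘(ℝ, E) q) :
    christoffel g q u (v + v') = christoffel g q u v + christoffel g q u v' := by
  rw [christoffel_comm hg, christoffel_add_left hg, christoffel_comm hg v, christoffel_comm hg v']

theorem christoffel_smul_right (hg : IsRegularAt g q) (c : ℝ) (u v : TangentSpace 𝓘(ℝ, E) q) :
    christoffel g q u (c • v) = c • christoffel g q u v := by
  rw [christoffel_comm hg, christoffel_smul_left hg, christoffel_comm hg v]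

end Christoffel

/-! ### Locality, additivity, Leibniz rule and metric compatibility -/

section Rules

variable {g : FormField E N} {φ : M → N} {s t : ∀ p : M, TangentSpace 𝓘(ℝ, E) (φ p)} {p : M}

theorem covAlong_congr (h : ∀ᶠ p' in 𝓝 p, s p' = t p') (v : TangentSpace 𝓘(ℝ, F) p) :
    covAlong g φ s p v = covAlong g φ t p v := by
  have h1 : (fun p' ↦ coord (φ p) (s p')) =ᶠ[𝓝 p] (fun p' ↦ coord (φ p) (t p')) :=
    h.mono fun p' hp' ↦ by simp only [hp']
  have h2 : derivCoord φ s p v = derivCoord φ t p v :=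
    congrArg (fun L : F →L[ℝ] E ↦ L v) h1.mfderiv_eq
  rw [covAlong_eq, covAlong_eq, h.self_of_nhds, h2]

theorem DiffAlongAt.congr (hs : DiffAlongAt (F := F) φ s p) (h : ∀ᶠ p' in 𝓝 p, t p' = s p') :
    DiffAlongAt (F := F) φ t p :=
  MDifferentiableAt.congr_of_eventuallyEq hs (h.mono fun p' hp' ↦ by simp only [hp'])

omit [IsManifold 𝓘(ℝ, E) ∞ N] in
theorem eventually_mem_source (hs : MDifferentiableAt 𝓘(ℝ, F) 𝓘(ℝ, E) φ p) :
    ∀ᶠ p' in 𝓝 p, φ p' ∈ (extChartAt 𝓘(ℝ, E) (φ p)).source :=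
  hs.continuousAt.preimage_mem_nhds (extChartAt_source_mem_nhds (I := 𝓘(ℝ, E)) (φ p))

theorem DiffAlongAt.add (hs : DiffAlongAt (F := F) φ s p) (ht : DiffAlongAt (F := F) φ t p) :
    DiffAlongAt (F := F) φ (fun p' ↦ s p' + t p') p := by
  rw [diffAlongAt_iff] at *
  refine ⟨hs.1, (hs.2.add ht.2).congr_of_eventuallyEq ?_⟩
  filter_upwards [eventually_mem_source hs.1] with p' hp'
  exact coord_add hp' _ _

theorem DiffAlongAt.smul {a : M → ℝ} (ha : MDifferentiableAt 𝓘(ℝ, F) 𝓘(ℝ, ℝ) a p)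
    (hs : DiffAlongAt (F := F) φ s p) :
    DiffAlongAt (F := F) φ (fun p' ↦ a p' • s p') p := by
  rw [diffAlongAt_iff] at *
  refine ⟨hs.1, (ha.smul hs.2).congr_of_eventuallyEq ?_⟩
  filter_upwards [eventually_mem_source hs.1] with p' hp'
  exact coord_smul hp' _ _

theorem covAlong_add (hg : IsRegularAt g (φ p)) (hs : DiffAlongAt (F := F) φ s p)
    (ht : DiffAlongAt (F := F) φ t p) (v : TangentSpace 𝓘(ℝ, F) p) :
    covAlong g φ (fun p' ↦ s p' + t p') p v = covAlong g φ s p v + covAlong g φ t p v := by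
  rw [diffAlongAt_iff] at hs ht
  have h1 : (fun p' ↦ coord (φ p) (s p' + t p')) =ᶠ[𝓝 p]
      (fun p' ↦ coord (φ p) (s p')) + (fun p' ↦ coord (φ p) (t p')) := by
    filter_upwards [eventually_mem_source hs.1] with p' hp'
    exact coord_add hp' _ _
  have h2 : derivCoord φ (fun p' ↦ s p' + t p') p v =
      derivCoord φ s p v + derivCoord φ t p v := by
    have h3 : mvfderiv 𝓘(ℝ, F) (fun p' ↦ coord (φ p) (s p' + t p')) p = mvfderiv 𝓘(ℝ, F) _ p :=
      h1.mfderiv_eq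
    rw [mvfderiv_add hs.2 ht.2] at h3
    exact congrArg (fun L : F →L[ℝ] E ↦ L v) h3
  rw [covAlong_eq, covAlong_eq, covAlong_eq, christoffel_add_right hg, h2]
  exact add_add_add_comm _ _ _ _

theorem covAlong_smul (hg : IsRegularAt g (φ p)) {a : M → ℝ}
    (ha : MDifferentiableAt 𝓘(ℝ, F) 𝓘(ℝ, ℝ) a p) (hs : DiffAlongAt (F := F) φ s p)
    (v : TangentSpace 𝓘(ℝ, F) p) :
    covAlong g φ (fun p' ↦ a p' • s p') p v =
      a p • covAlong g φ s p v + mvfderiv 𝓘(ℝ, F) a p v • s p := by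
  rw [diffAlongAt_iff] at hs
  have h1 : (fun p' ↦ coord (φ p) (a p' • s p')) =ᶠ[𝓝 p]
      a • (fun p' ↦ coord (φ p) (s p')) := by
    filter_upwards [eventually_mem_source hs.1] with p' hp'
    exact coord_smul hp' _ _
  have h2 : derivCoord φ (fun p' ↦ a p' • s p') p v =
      a p • derivCoord φ s p v + mvfderiv 𝓘(ℝ, F) a p v • s p := by
    have h3 : mvfderiv 𝓘(ℝ, F) (fun p' ↦ coord (φ p) (a p' • s p')) p = mvfderiv 𝓘(ℝ, F) _ p :=
      h1.mfderiv_eq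
    rw [mvfderiv_smul ha hs.2, coord_self] at h3
    exact congrArg (fun L : F →L[ℝ] E ↦ L v) h3
  rw [covAlong_eq, covAlong_eq, christoffel_smul_right hg, h2, smul_add]
  exact add_right_comm _ _ _

theorem covAlong_zero (hg : IsRegularAt g (φ p)) (hφ : MDifferentiableAt 𝓘(ℝ, F) 𝓘(ℝ, E) φ p)
    (v : TangentSpace 𝓘(ℝ, F) p) :
    covAlong g φ (fun p' ↦ (0 : TangentSpace 𝓘(ℝ, E) (φ p'))) p v = 0 := by
  have h1 : (fun p' ↦ coord (φ p) (0 : TangentSpace 𝓘(ℝ, E) (φ p'))) =ᶠ[𝓝 p] (0 : M → E) := by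
    filter_upwards [eventually_mem_source hφ] with p' hp'
    have := coord_smul hp' 0 (0 : TangentSpace 𝓘(ℝ, E) (φ p'))
    simpa using this
  have h3 : mvfderiv 𝓘(ℝ, F) (fun p' ↦ coord (φ p) (0 : TangentSpace 𝓘(ℝ, E) (φ p'))) p =
      mvfderiv 𝓘(ℝ, F) (0 : M → E) p := h1.mfderiv_eq
  have h4 := christoffel_smul_right hg 0 (differential E F φ p v) 0
  rw [zero_smul, zero_smul] at h4
  rw [mvfderiv_zero] at h3
  have h5 : derivCoord φ (fun p' ↦ (0 : TangentSpace 𝓘(ℝ, E) (φ p'))) p v = 0 :=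
    congrArg (fun L : F →L[ℝ] E ↦ L v) h3
  rw [covAlong_eq, h4, h5, add_zero]

/-- The Levi-Civita connection is metric. -/
theorem mvfderiv_metric (hg : IsRegularAt g (φ p)) (hs : DiffAlongAt (F := F) φ s p)
    (ht : DiffAlongAt (F := F) φ t p) :
    MDifferentiableAt 𝓘(ℝ, F) 𝓘(ℝ, ℝ) (fun p' ↦ g (φ p') (s p') (t p')) p ∧
    ∀ v : TangentSpace 𝓘(ℝ, F) p, mvfderiv 𝓘(ℝ, F) (fun p' ↦ g (φ p') (s p') (t p')) p v =
      g (φ p) (covAlong g φ s p v) (t p) + g (φ p) (s p) (covAlong g φ t p v) := by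
  rw [diffAlongAt_iff] at hs ht
  have hx := extChartAt_to_inv (I := 𝓘(ℝ, F)) p
  set x := extChartAt 𝓘(ℝ, F) p p
  have hφ := hasFDerivAt_chart_comp_symm hs.1
  have hsd := hasFDerivAt_comp_symm hs.2
  have htd := hasFDerivAt_comp_symm ht.2
  set c := extChartAt 𝓘(ℝ, F) p
  set G := chartForm g (φ p)
  have hG : HasFDerivAt G (fderiv ℝ G (extChartAt 𝓘(ℝ, E) (φ p) (φ p)))
      (extChartAt 𝓘(ℝ, E) (φ p) (φ (c.symm x))) := by
    rw [hx]
    exact hg.differentiableAt.hasFDerivAt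
  have hGφ := HasFDerivAt.comp (g := G) x hG hφ
  have htot := (hGφ.clm_apply hsd).clm_apply htd
  have heq : (fun z ↦ g (φ (c.symm z)) (s (c.symm z)) (t (c.symm z))) =ᶠ[𝓝 x] fun z ↦
      G (extChartAt 𝓘(ℝ, E) (φ p) (φ (c.symm z))) (coord (φ p) (s (c.symm z)))
        (coord (φ p) (t (c.symm z))) := by
    filter_upwards [(tendsto_extChartAt_symm (F := F) p).eventually
      (eventually_mem_source hs.1)] with z hz
    exact (chartForm_coord g hz _ _).symm
  have hcont : ContinuousAt (fun p' ↦ g (φ p') (s p') (t p')) p := by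
    have h1 : ContinuousAt (fun p' ↦ extChartAt 𝓘(ℝ, E) (φ p) (φ p')) p :=
      (continuousAt_extChartAt (I := 𝓘(ℝ, E)) (φ p)).comp hs.1.continuousAt
    have h2 : ContinuousAt (fun p' ↦ G (extChartAt 𝓘(ℝ, E) (φ p) (φ p'))) p :=
      ContinuousAt.comp (g := G) hg.differentiableAt.continuousAt h1
    have h3 := (h2.clm_apply hs.2.continuousAt).clm_apply ht.2.continuousAt
    refine h3.congr ?_
    filter_upwards [eventually_mem_source hs.1] with z hz
    exact chartForm_coord g hz _ _
  obtain ⟨h1, h2⟩ := mvfderiv_of_hasFDerivAt hcont (htot.congr_of_eventuallyEq heq)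
  refine ⟨h1, fun v ↦ ?_⟩
  -- The two Christoffel contributions add up to the derivative of the metric coefficients, the
  -- third term of the product rule.
  have hk := koszulCovector_add_koszulCovector hg.differentiableAt
    (Filter.Eventually.of_forall fun z ↦ chartForm_symm hg.symm (φ p) z)
    (differential E F φ p v) (s p) (t p)
  have hm := metric_christoffel hg (differential E F φ p v) (s p) (t p)
  have hm' := metric_christoffel hg (differential E F φ p v) (t p) (s p)
  rw [hg.symm] at hm'
  rw [covAlong_eq, covAlong_eq, map_add, map_add, add_apply, hm, hm']
  have e1 : ∀ a b : TangentSpace 𝓘(ℝ, E) (φ p),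
      G (extChartAt 𝓘(ℝ, E) (φ p) (φ (c.symm x))) a b = g (φ p) a b := by
    rw [hx]
    exact chartForm_self g (φ p)
  have e2 : coord (φ p) (s (c.symm x)) = s p := by rw [hx]; exact coord_self _
  have e3 : coord (φ p) (t (c.symm x)) = t p := by rw [hx]; exact coord_self _
  have h3 : mvfderiv 𝓘(ℝ, F) (fun p' ↦ g (φ p') (s p') (t p')) p v =
      G (extChartAt 𝓘(ℝ, E) (φ p) (φ (c.symm x))) (coord (φ p) (s (c.symm x)))
        (derivCoord φ t p v) +
      (G (extChartAt 𝓘(ℝ, E) (φ p) (φ (c.symm x))) (derivCoord φ s p v)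
        (coord (φ p) (t (c.symm x))) +
      fderiv ℝ G (extChartAt 𝓘(ℝ, E) (φ p) (φ p)) (differential E F φ p v)
        (coord (φ p) (s (c.symm x))) (coord (φ p) (t (c.symm x)))) :=
    congrArg (fun L : F →L[ℝ] ℝ ↦ L v) h2
  rw [e2, e3, e1, e1, ← hk] at h3
  rw [h3]
  ring

end Rules

end CovAlong

/-! ## The Gauss formula -/

section Gauss

variable {E : Type*} [NormedAddCommGroup E] [NormedSpace ℝ E]
  {N : Type*} [TopologicalSpace N] [ChartedSpace E N] [IsManifold 𝓘(ℝ, E) ∞ N]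
  {E' : Type*} [NormedAddCommGroup E'] [NormedSpace ℝ E']
  {N' : Type*} [TopologicalSpace N'] [ChartedSpace E' N'] [IsManifold 𝓘(ℝ, E') ∞ N']
  {F : Type*} [NormedAddCommGroup F] [NormedSpace ℝ F]
  {M : Type*} [TopologicalSpace M] [ChartedSpace F M]

/-- The map `Φ` in the preferred charts at `q` and `Φ q`. -/
def inChart (E E' : Type*) [NormedAddCommGroup E] [NormedSpace ℝ E]
    [NormedAddCommGroup E'] [NormedSpace ℝ E'] {N : Type*} [TopologicalSpace N] [ChartedSpace E N]
    {N' : Type*} [TopologicalSpace N'] [ChartedSpace E' N'] (Φ : N → N') (q : N) (x : E) : E' :=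
  extChartAt 𝓘(ℝ, E') (Φ q) (Φ ((extChartAt 𝓘(ℝ, E) q).symm x))

variable {Φ : N → N'} {q : N}

omit [IsManifold 𝓘(ℝ, E) ∞ N] [IsManifold 𝓘(ℝ, E') ∞ N'] in
theorem contDiffAt_inChart (hΦ : ContMDiffAt 𝓘(ℝ, E) 𝓘(ℝ, E') 2 Φ q) :
    ContDiffAt ℝ 2 (inChart E E' Φ q) (extChartAt 𝓘(ℝ, E) q q) := by
  have h := (contMDiffAt_iff.1 hΦ).2
  rw [modelWithCornersSelf_coe, range_id, contDiffWithinAt_univ] at h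
  exact h

omit [IsManifold 𝓘(ℝ, E) ∞ N] [IsManifold 𝓘(ℝ, E') ∞ N'] in
theorem fderiv_inChart (hΦ : ContMDiffAt 𝓘(ℝ, E) 𝓘(ℝ, E') 2 Φ q)
    (u : TangentSpace 𝓘(ℝ, E) q) :
    fderiv ℝ (inChart E E' Φ q) (extChartAt 𝓘(ℝ, E) q q) u = differential E' E Φ q u := by
  have hd : HasFDerivAt (inChart E E' Φ q) (differential E' E Φ q : E →L[ℝ] E')
      (extChartAt 𝓘(ℝ, E) q q) :=
    hasFDerivAt_chart_comp_symm (hΦ.mdifferentiableAt (by norm_num))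
  exact congrArg (fun L : E →L[ℝ] E' ↦ L u) (HasFDerivAt.fderiv (E := E) (F := E') hd)

theorem eventually_mdifferentiableAt (hΦ : ContMDiffAt 𝓘(ℝ, E) 𝓘(ℝ, E') 2 Φ q) :
    ∀ᶠ q' in 𝓝 q, MDifferentiableAt 𝓘(ℝ, E) 𝓘(ℝ, E') Φ q' :=
  ((contMDiffAt_iff_contMDiffAt_nhds (by simp)).1 hΦ).mono fun _ h ↦ h.mdifferentiableAt (by norm_num)

/-- The second derivative of `Φ` in the preferred charts. -/
def secondDeriv (E E' : Type*) [NormedAddCommGroup E] [NormedSpace ℝ E]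
    [NormedAddCommGroup E'] [NormedSpace ℝ E'] {N : Type*} [TopologicalSpace N] [ChartedSpace E N]
    {N' : Type*} [TopologicalSpace N'] [ChartedSpace E' N'] (Φ : N → N') (q : N)
    (u w : TangentSpace 𝓘(ℝ, E) q) : TangentSpace 𝓘(ℝ, E') (Φ q) :=
  fderiv ℝ (fderiv ℝ (inChart E E' Φ q)) (extChartAt 𝓘(ℝ, E) q q) u w

section Derivative

variable {φ : M → N} {s : ∀ p : M, TangentSpace 𝓘(ℝ, E) (φ p)} {p : M}

/-- Product rule for `DΦ` applied to `s`, in charts. The Hessian term is the part of the second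
fundamental form that comes from `Φ` itself. -/
theorem derivCoord_differential (hΦ : ContMDiffAt 𝓘(ℝ, E) 𝓘(ℝ, E') 2 Φ (φ p))
    (hs : DiffAlongAt (F := F) φ s p) :
    DiffAlongAt (F := F) (fun p' ↦ Φ (φ p')) (fun p' ↦ differential E' E Φ (φ p') (s p')) p ∧
    ∀ v : TangentSpace 𝓘(ℝ, F) p,
      derivCoord (fun p' ↦ Φ (φ p')) (fun p' ↦ differential E' E Φ (φ p') (s p')) p v =
        secondDeriv E E' Φ (φ p) (differential E F φ p v) (s p)
          + differential E' E Φ (φ p) (derivCoord φ s p v) := by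
  rw [diffAlongAt_iff] at hs
  have hΦd : MDifferentiableAt 𝓘(ℝ, E) 𝓘(ℝ, E') Φ (φ p) := hΦ.mdifferentiableAt (by norm_num)
  have hx := extChartAt_to_inv (I := 𝓘(ℝ, F)) p
  have hev : ∀ᶠ p' in 𝓝 p, coord (Φ (φ p)) (differential E' E Φ (φ p') (s p')) =
      fderiv ℝ (inChart E E' Φ (φ p)) (extChartAt 𝓘(ℝ, E) (φ p) (φ p')) (coord (φ p) (s p')) := by
    filter_upwards [eventually_mem_source hs.1,
      eventually_mem_source (MDifferentiableAt.comp (g := Φ) p hΦd hs.1),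
      hs.1.continuousAt.eventually (eventually_mdifferentiableAt hΦ)] with p' h1 h2 h3
    exact coord_differential h1 h2 h3 _
  set x := extChartAt 𝓘(ℝ, F) p p
  have hφ := hasFDerivAt_chart_comp_symm hs.1
  have hsd := hasFDerivAt_comp_symm hs.2
  set c := extChartAt 𝓘(ℝ, F) p
  set D := fderiv ℝ (inChart E E' Φ (φ p)) with hD
  have hDd : DifferentiableAt ℝ D (extChartAt 𝓘(ℝ, E) (φ p) (φ p)) :=
    ((contDiffAt_inChart hΦ).fderiv_right (m := 1) (by norm_num)).differentiableAt (by norm_num)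
  have hD' : HasFDerivAt D (fderiv ℝ D (extChartAt 𝓘(ℝ, E) (φ p) (φ p)))
      (extChartAt 𝓘(ℝ, E) (φ p) (φ (c.symm x))) := by
    rw [hx]
    exact hDd.hasFDerivAt
  have htot := (HasFDerivAt.comp (g := D) x hD' hφ).clm_apply hsd
  have hcont : ContinuousAt
      (fun p' ↦ coord (Φ (φ p)) (differential E' E Φ (φ p') (s p'))) p := by
    have h1 : ContinuousAt (fun p' ↦ extChartAt 𝓘(ℝ, E) (φ p) (φ p')) p :=
      (continuousAt_extChartAt (I := 𝓘(ℝ, E)) (φ p)).comp hs.1.continuousAt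
    have h2 : ContinuousAt (fun p' ↦ D (extChartAt 𝓘(ℝ, E) (φ p) (φ p'))) p :=
      ContinuousAt.comp (g := D) hDd.continuousAt h1
    exact (h2.clm_apply hs.2.continuousAt).congr (hev.mono fun _ h ↦ h.symm)
  obtain ⟨h1, h2⟩ := mvfderiv_of_hasFDerivAt hcont
    (htot.congr_of_eventuallyEq ((tendsto_extChartAt_symm (F := F) p).eventually hev))
  refine ⟨diffAlongAt_iff.2 ⟨MDifferentiableAt.comp (g := Φ) p hΦd hs.1, h1⟩, fun v ↦ ?_⟩
  have e2 : coord (φ p) (s (c.symm x)) = s p := by rw [hx]; exact coord_self _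
  have e1 : D (extChartAt 𝓘(ℝ, E) (φ p) (φ (c.symm x))) =
      D (extChartAt 𝓘(ℝ, E) (φ p) (φ p)) := by rw [hx]
  have h3 : derivCoord (fun p' ↦ Φ (φ p')) (fun p' ↦ differential E' E Φ (φ p') (s p')) p v =
      D (extChartAt 𝓘(ℝ, E) (φ p) (φ (c.symm x))) (derivCoord φ s p v) +
      fderiv ℝ D (extChartAt 𝓘(ℝ, E) (φ p) (φ p)) (differential E F φ p v)
        (coord (φ p) (s (c.symm x))) :=
    congrArg (fun L : F →L[ℝ] E' ↦ L v) h2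
  rw [e2, e1, hD, fderiv_inChart hΦ] at h3
  exact h3.trans (add_comm _ _)

end Derivative

/-- Puts the induced metric in the shape required by `koszulCovector_pullback`. It holds on a whole
neighbourhood, as it has to be differentiated. -/
theorem chartForm_inducedMetric (g : FormField E' N') (hΦ : ContMDiffAt 𝓘(ℝ, E) 𝓘(ℝ, E') 2 Φ q) :
    ∀ᶠ z in 𝓝 (extChartAt 𝓘(ℝ, E) q q), ∀ a b : E,
      chartForm (inducedMetric g Φ) q z a b = chartForm g (Φ q) (inChart E E' Φ q z)
        (fderiv ℝ (inChart E E' Φ q) z a) (fderiv ℝ (inChart E E' Φ q) z b) := by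
  have h0 := tendsto_extChartAt_symm (F := E) q
  filter_upwards [h0.eventually (eventually_mdifferentiableAt hΦ),
    h0.eventually (eventually_mem_source (hΦ.mdifferentiableAt (by norm_num))),
    extChartAt_target_mem_nhds (I := 𝓘(ℝ, E)) q] with z h1 h2 hz a b
  have hs := (extChartAt 𝓘(ℝ, E) q).map_target hz
  have e := (extChartAt 𝓘(ℝ, E) q).right_inv hz
  have key : ∀ a, coord (Φ q) (differential E' E Φ ((extChartAt 𝓘(ℝ, E) q).symm z)
      (ofCoord q ((extChartAt 𝓘(ℝ, E) q).symm z) a)) = fderiv ℝ (inChart E E' Φ q) z a := by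
    intro a
    rw [coord_differential hs h2 h1, coord_ofCoord hs, e]
    rfl
  rw [← key, ← key]
  exact (chartForm_coord g h2 _ _).symm

theorem IsRegularAt.induced {g : FormField E' N'} (hg : IsRegularAt g (Φ q))
    (hΦ : ContMDiffAt 𝓘(ℝ, E) 𝓘(ℝ, E') 2 Φ q)
    (hi : (formAt (inducedMetric (F := E) g Φ) q).IsInvertible) :
    IsRegularAt (inducedMetric (F := E) g Φ) q where
  symm q' _ _ := hg.symm (Φ q') _ _
  invertible := hi
  differentiableAt := by
    refine differentiableAt_of_eventuallyEq_pullback (G := chartForm g (Φ q))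
      (contDiffAt_inChart hΦ) ?_ (chartForm_inducedMetric g hΦ)
    simpa only [inChart, extChartAt_to_inv] using hg.differentiableAt

/-- The second fundamental form of `Φ`, as the difference of the ambient and the induced
connections. -/
def gaussForm (E : Type*) [NormedAddCommGroup E] [NormedSpace ℝ E]
    {N : Type*} [TopologicalSpace N] [ChartedSpace E N] [IsManifold 𝓘(ℝ, E) ∞ N]
    (g : FormField E' N') (Φ : N → N') (q : N) (u w : TangentSpace 𝓘(ℝ, E) q) :
    TangentSpace 𝓘(ℝ, E') (Φ q) :=
  secondDeriv E E' Φ q u w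
    + christoffel g (Φ q) (differential E' E Φ q u) (differential E' E Φ q w)
    - differential E' E Φ q (christoffel (inducedMetric g Φ) q u w)

/-- `gaussForm` is defined to collect exactly the Hessian and the two Christoffel terms. The field
lives along an arbitrary `φ` so that the lemma gives both the Gauss formula (`φ` the identity) and
the change of chart (`Φ` a chart). -/
theorem covAlong_differential (g : FormField E' N') {φ : M → N}
    {s : ∀ p : M, TangentSpace 𝓘(ℝ, E) (φ p)} {p : M}
    (hΦ : ContMDiffAt 𝓘(ℝ, E) 𝓘(ℝ, E') 2 Φ (φ p)) (hs : DiffAlongAt (F := F) φ s p)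
    (v : TangentSpace 𝓘(ℝ, F) p) :
    covAlong g (fun p' ↦ Φ (φ p')) (fun p' ↦ differential E' E Φ (φ p') (s p')) p v =
      differential E' E Φ (φ p) (covAlong (inducedMetric g Φ) φ s p v)
        + gaussForm E g Φ (φ p) (differential E F φ p v) (s p) := by
  have hc : differential E' F (fun p' ↦ Φ (φ p')) p v =
      differential E' E Φ (φ p) (differential E F φ p v) := by
    have := mfderiv_comp (g := Φ) (f := φ) p (hΦ.mdifferentiableAt (by norm_num))
      (diffAlongAt_iff.1 hs).1
    exact congrArg (fun L : F →L[ℝ] E' ↦ L v) this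
  rw [covAlong_eq, (derivCoord_differential hΦ hs).2 v, covAlong_eq, map_add, gaussForm, hc]
  abel

section GaussForm

variable {g : FormField E' N'} (hg : IsRegularAt g (Φ q))
  (hi : (formAt (inducedMetric (F := E) g Φ) q).IsInvertible)
  (hΦ : ContMDiffAt 𝓘(ℝ, E) 𝓘(ℝ, E') 2 Φ q)

include hg hi hΦ

/-- Paired with a tangent vector, the three terms of `gaussForm` cancel by the transformation law
`koszulCovector_pullback`. -/
theorem metric_gaussForm (u v w : TangentSpace 𝓘(ℝ, E) q) :
    g (Φ q) (gaussForm E g Φ q u v) (differential E' E Φ q w) = 0 := by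
  have hr := hg.induced hΦ hi
  have hq : inChart E E' Φ q (extChartAt 𝓘(ℝ, E) q q) = extChartAt 𝓘(ℝ, E') (Φ q) (Φ q) := by
    simp only [inChart, extChartAt_to_inv]
  have hk := koszulCovector_pullback (contDiffAt_inChart hΦ)
    (G := chartForm g (Φ q)) (by rw [hq]; exact hg.differentiableAt)
    (fun _ _ ↦ chartForm_symm hg.symm _ _ _ _) (chartForm_inducedMetric g hΦ) u v w
  rw [hq, fderiv_inChart hΦ, fderiv_inChart hΦ, fderiv_inChart hΦ] at hk
  have h1 := metric_christoffel hr u v w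
  have h2 := metric_christoffel hg (differential E' E Φ q u) (differential E' E Φ q v)
    (differential E' E Φ q w)
  have h3 : chartForm g (Φ q) (extChartAt 𝓘(ℝ, E') (Φ q) (Φ q))
      (secondDeriv E E' Φ q u v) (differential E' E Φ q w) =
      g (Φ q) (secondDeriv E E' Φ q u v) (differential E' E Φ q w) := chartForm_self _ _ _ _
  have h4 : inducedMetric g Φ q (christoffel (inducedMetric g Φ) q u v) w =
      g (Φ q) (differential E' E Φ q (christoffel (inducedMetric g Φ) q u v))
        (differential E' E Φ q w) := rfl
  rw [h4] at h1
  rw [gaussForm, map_sub, map_add, sub_apply, add_apply, h1, h2, ← h3]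
  rw [sub_eq_zero]
  exact (add_comm _ _).trans hk.symm

theorem gaussForm_comm (u v : TangentSpace 𝓘(ℝ, E) q) :
    gaussForm E g Φ q u v = gaussForm E g Φ q v u := by
  have h : secondDeriv E E' Φ q u v = secondDeriv E E' Φ q v u :=
    (contDiffAt_inChart hΦ).isSymmSndFDerivAt (by simp) u v
  rw [gaussForm, gaussForm, h, christoffel_comm hg, christoffel_comm (hg.induced hΦ hi)]

theorem gaussForm_add_left (u u' v : TangentSpace 𝓘(ℝ, E) q) :
    gaussForm E g Φ q (u + u') v = gaussForm E g Φ q u v + gaussForm E g Φ q u' v := by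
  have h : secondDeriv E E' Φ q (u + u') v = secondDeriv E E' Φ q u v + secondDeriv E E' Φ q u' v :=
    congrArg (fun L : E →L[ℝ] E' ↦ L v)
      (map_add (fderiv ℝ (fderiv ℝ (inChart E E' Φ q)) (extChartAt 𝓘(ℝ, E) q q)) u u')
  rw [gaussForm, gaussForm, gaussForm, h, map_add, christoffel_add_left hg,
    christoffel_add_left (hg.induced hΦ hi), map_add]
  abel

theorem gaussForm_smul_left (c : ℝ) (u v : TangentSpace 𝓘(ℝ, E) q) :
    gaussForm E g Φ q (c • u) v = c • gaussForm E g Φ q u v := by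
  have h : secondDeriv E E' Φ q (c • u) v = c • secondDeriv E E' Φ q u v :=
    congrArg (fun L : E →L[ℝ] E' ↦ L v)
      (map_smul (fderiv ℝ (fderiv ℝ (inChart E E' Φ q)) (extChartAt 𝓘(ℝ, E) q q)) c u)
  rw [gaussForm, gaussForm, h, map_smul, christoffel_smul_left hg,
    christoffel_smul_left (hg.induced hΦ hi), map_smul, smul_sub, smul_add]

end GaussForm

end Gauss

/-! ## Smooth fields along maps -/

section Smooth

variable {E : Type*} [NormedAddCommGroup E] [NormedSpace ℝ E]
  {N : Type*} [TopologicalSpace N] [ChartedSpace E N] [IsManifold 𝓘(ℝ, E) ∞ N]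
  {F : Type*} [NormedAddCommGroup F] [NormedSpace ℝ F]
  {M : Type*} [TopologicalSpace M] [ChartedSpace F M]

/-- Smoothness at a point of a vector field along a map. -/
def SmoothAlongAt (φ : M → N) (s : ∀ p : M, TangentSpace 𝓘(ℝ, E) (φ p)) (p : M) : Prop :=
  ContMDiffAt 𝓘(ℝ, F) (𝓘(ℝ, E).prod 𝓘(ℝ, E)) ∞
    (fun p ↦ (⟨φ p, s p⟩ : TotalSpace E (TangentSpace 𝓘(ℝ, E) : N → Type _))) p

section

variable {φ : M → N} {s t : ∀ p : M, TangentSpace 𝓘(ℝ, E) (φ p)} {p : M}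

theorem smoothAlongAt_iff {q₀ : N} (hp : φ p ∈ (extChartAt 𝓘(ℝ, E) q₀).source) :
    SmoothAlongAt (F := F) φ s p ↔ ContMDiffAt 𝓘(ℝ, F) 𝓘(ℝ, E) ∞ φ p ∧
      ContMDiffAt 𝓘(ℝ, F) 𝓘(ℝ, E) ∞ (fun p' ↦ coord q₀ (s p')) p :=
  Bundle.Trivialization.contMDiffAt_iff
    (e := trivializationAt E (TangentSpace 𝓘(ℝ, E) : N → Type _) q₀)
    (f := fun p ↦ (⟨φ p, s p⟩ : TotalSpace E (TangentSpace 𝓘(ℝ, E) : N → Type _)))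
    ((Bundle.Trivialization.mem_source _).2 (mem_baseSet_iff.2 hp))

theorem SmoothAlongAt.contMDiffAt (hs : SmoothAlongAt (F := F) φ s p) :
    ContMDiffAt 𝓘(ℝ, F) 𝓘(ℝ, E) ∞ φ p :=
  ((smoothAlongAt_iff (mem_extChartAt_source (φ p))).1 hs).1

theorem SmoothAlongAt.diffAlongAt (hs : SmoothAlongAt (F := F) φ s p) :
    DiffAlongAt (F := F) φ s p :=
  ContMDiffAt.mdifferentiableAt hs (by simp)

theorem SmoothAlongAt.eventually [IsManifold 𝓘(ℝ, F) ∞ M] (hs : SmoothAlongAt (F := F) φ s p) :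
    ∀ᶠ p' in 𝓝 p, DiffAlongAt (F := F) φ s p' := by
  have h1 : ContMDiffAt 𝓘(ℝ, F) (𝓘(ℝ, E).prod 𝓘(ℝ, E)) 1
      (fun p ↦ (⟨φ p, s p⟩ : TotalSpace E (TangentSpace 𝓘(ℝ, E) : N → Type _))) p :=
    ContMDiffAt.of_le hs (by simp)
  exact ((contMDiffAt_iff_contMDiffAt_nhds (by simp)).1 h1).mono
    fun _ h ↦ h.mdifferentiableAt (by norm_num)

theorem SmoothAlongAt.congr (hs : SmoothAlongAt (F := F) φ s p)
    (h : ∀ᶠ p' in 𝓝 p, t p' = s p') : SmoothAlongAt (F := F) φ t p :=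
  ContMDiffAt.congr_of_eventuallyEq hs (h.mono fun p' hp' ↦ by simp only [hp'])

theorem SmoothAlongAt.add (hs : SmoothAlongAt (F := F) φ s p)
    (ht : SmoothAlongAt (F := F) φ t p) :
    SmoothAlongAt (F := F) φ (fun p' ↦ s p' + t p') p := by
  have hm := mem_extChartAt_source (I := 𝓘(ℝ, E)) (φ p)
  rw [smoothAlongAt_iff hm] at *
  refine ⟨hs.1, (hs.2.add ht.2).congr_of_eventuallyEq ?_⟩
  filter_upwards [eventually_mem_source (hs.1.mdifferentiableAt (by simp))] with p' hp'
  exact coord_add hp' _ _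

theorem SmoothAlongAt.smul {a : M → ℝ} (ha : ContMDiffAt 𝓘(ℝ, F) 𝓘(ℝ, ℝ) ∞ a p)
    (hs : SmoothAlongAt (F := F) φ s p) :
    SmoothAlongAt (F := F) φ (fun p' ↦ a p' • s p') p := by
  have hm := mem_extChartAt_source (I := 𝓘(ℝ, E)) (φ p)
  rw [smoothAlongAt_iff hm] at *
  refine ⟨hs.1, (ha.smul hs.2).congr_of_eventuallyEq ?_⟩
  filter_upwards [eventually_mem_source (hs.1.mdifferentiableAt (by simp))] with p' hp'
  exact coord_smul hp' _ _

end

theorem smoothAlongAt_ofCoord {q₀ q : N} (hq : q ∈ (extChartAt 𝓘(ℝ, E) q₀).source) (a : E) :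
    SmoothAlongAt (F := E) (fun q : N ↦ q) (fun q ↦ ofCoord q₀ q a) q := by
  rw [smoothAlongAt_iff hq]
  refine ⟨contMDiffAt_id, (contMDiffAt_const (c := a)).congr_of_eventuallyEq ?_⟩
  filter_upwards [extChartAt_source_mem_nhds' (I := 𝓘(ℝ, E)) hq] with z hz
  exact coord_ofCoord hz a

theorem SmoothAlongAt.comp {φ : M → N} {X : VField E N} {p : M}
    (hX : SmoothAlongAt (F := E) (fun q : N ↦ q) X (φ p))
    (hφ : ContMDiffAt 𝓘(ℝ, F) 𝓘(ℝ, E) ∞ φ p) :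
    SmoothAlongAt (F := F) φ (fun p' ↦ X (φ p')) p :=
  ContMDiffAt.comp (g := fun q ↦ (⟨q, X q⟩ : TotalSpace E (TangentSpace 𝓘(ℝ, E) : N → Type _)))
    (f := φ) p hX hφ

/-- Every tangent vector extends to a smooth vector field, with constant coordinates nearby. -/
theorem exists_smoothField [FiniteDimensional ℝ E] [T2Space N] (q : N) (a : E) :
    ∃ X : VField E N, SmoothField X ∧ ∀ᶠ q' in 𝓝 q, X q' = ofCoord q q' a := by
  obtain ⟨f⟩ : Nonempty (SmoothBumpFunction 𝓘(ℝ, E) q) := inferInstance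
  refine ⟨fun q' ↦ f q' • ofCoord q q' a, ?_, ?_⟩
  · refine ContMDiffOn.smul_section_of_tsupport (u := (chartAt E q).source)
      (s := fun q' ↦ ofCoord q q' a) (ψ := f)
      f.contMDiff.contMDiffOn (chartAt E q).open_source f.tsupport_subset_chartAt_source ?_
    intro q' hq'
    refine ContMDiffAt.contMDiffWithinAt ?_
    exact smoothAlongAt_ofCoord (by rwa [extChartAt_source]) a
  · filter_upwards [f.eventuallyEq_one] with q' hq'
    rw [hq', Pi.one_apply, one_smul]

theorem coord_model (y₀ : E) {y : E} (u : TangentSpace 𝓘(ℝ, E) y) : coord y₀ u = u :=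
  congrArg Prod.snd (trivializationAt_model_space_apply (I := 𝓘(ℝ, E)) ⟨y, u⟩ y₀)

section

variable [IsManifold 𝓘(ℝ, F) ∞ M]

theorem smoothAlongAt_differential {φ : M → N} {V : VField F M} {p : M}
    (hφ : ContMDiffAt 𝓘(ℝ, F) 𝓘(ℝ, E) ∞ φ p) (hV : SmoothAlongAt (F := F) (fun p : M ↦ p) V p) :
    SmoothAlongAt (F := F) φ (fun p' ↦ differential E F φ p' (V p')) p :=
  ContMDiffAt.clm_apply_of_inCoordinates (b₁ := fun p : M ↦ p) (b₂ := φ) (v := V)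
    (ϕ := fun p ↦ differential E F φ p)
    (ContMDiffAt.mfderiv_const hφ (by simp)) hV hφ

theorem contMDiffAt_mvfderiv {W : Type*} [NormedAddCommGroup W] [NormedSpace ℝ W] {f : M → W}
    {V : VField F M} {p : M} (hf : ContMDiffAt 𝓘(ℝ, F) 𝓘(ℝ, W) ∞ f p)
    (hV : SmoothAlongAt (F := F) (fun p : M ↦ p) V p) :
    ContMDiffAt 𝓘(ℝ, F) 𝓘(ℝ, W) ∞ (fun p' ↦ mvfderiv 𝓘(ℝ, F) f p' (V p')) p := by
  have h := ((smoothAlongAt_iff (mem_extChartAt_source (f p))).1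
    (smoothAlongAt_differential hf hV)).2
  refine h.congr_of_eventuallyEq (Filter.Eventually.of_forall fun p' ↦ ?_)
  exact (coord_model _ _).symm

end

/-- The metric `g` is smooth at `q`, as a section of the bundle of bilinear forms. -/
def SmoothFormAt (g : FormField E N) (q : N) : Prop :=
  ContMDiffAt 𝓘(ℝ, E) (𝓘(ℝ, E).prod 𝓘(ℝ, E →L[ℝ] E →L[ℝ] ℝ)) ∞
    (fun b ↦ TotalSpace.mk' (E →L[ℝ] E →L[ℝ] ℝ)
      (E := fun q : N ↦ TangentSpace 𝓘(ℝ, E) q →L[ℝ] TangentSpace 𝓘(ℝ, E) q →L[ℝ] ℝ) b (g b)) q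

theorem contMDiffAt_form {g : FormField E N} {φ : M → N}
    {s t : ∀ p : M, TangentSpace 𝓘(ℝ, E) (φ p)} {p : M}
    (hg : SmoothFormAt g (φ p)) (hs : SmoothAlongAt (F := F) φ s p)
    (ht : SmoothAlongAt (F := F) φ t p) :
    ContMDiffAt 𝓘(ℝ, F) 𝓘(ℝ, ℝ) ∞ (fun p' ↦ g (φ p') (s p') (t p')) p := by
  have h : ContMDiffAt 𝓘(ℝ, F) (𝓘(ℝ, E).prod 𝓘(ℝ, ℝ)) ∞
      (fun m ↦ TotalSpace.mk' ℝ (E := Bundle.Trivial N ℝ) (φ m) (g (φ m) (s m) (t m))) p := by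
    apply ContMDiffAt.clm_bundle_apply₂ (F₁ := E) (F₂ := E)
    · exact ContMDiffAt.comp p hg hs.contMDiffAt
    · exact hs
    · exact ht
  rw [contMDiffAt_totalSpace] at h
  exact h.2

/-- Smoothness on the whole chart domain, not only at its centre, allows neighbouring points to be
treated in one chart. Finite dimension reduces it to single matrix entries. -/
theorem contDiffOn_chartForm [FiniteDimensional ℝ E] {g : FormField E N}
    (hg : ∀ q, SmoothFormAt g q) (q₀ : N) :
    ContDiffOn ℝ ∞ (chartForm g q₀) (extChartAt 𝓘(ℝ, E) q₀).target := by
  rw [contDiffOn_clm_apply]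
  intro a
  rw [contDiffOn_clm_apply]
  intro b y hy
  have hq := (extChartAt 𝓘(ℝ, E) q₀).map_target hy
  have hsm : ContMDiffAt 𝓘(ℝ, E) 𝓘(ℝ, E) ∞ (extChartAt 𝓘(ℝ, E) q₀).symm y :=
    (contMDiffOn_extChartAt_symm q₀).contMDiffAt (extChartAt_target_mem_nhds' hy)
  have h := contMDiffAt_form (hg _) ((smoothAlongAt_ofCoord hq a).comp hsm)
    ((smoothAlongAt_ofCoord hq b).comp hsm)
  exact (contMDiffAt_iff_contDiffAt.1 h).contDiffWithinAt

theorem isRegularAt_of_smooth [FiniteDimensional ℝ E] {g : FormField E N}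
    (hsm : ∀ q, SmoothFormAt g q)
    (hs : ∀ (q : N) (v w : TangentSpace 𝓘(ℝ, E) q), g q v w = g q w v)
    (hpos : ∀ (q : N) (v : TangentSpace 𝓘(ℝ, E) q), v ≠ 0 → 0 < g q v v) (q : N) :
    IsRegularAt g q where
  symm := hs
  invertible := isInvertible_of_pos (hpos q)
  differentiableAt := ((contDiffOn_chartForm hsm q).contDiffAt
    (extChartAt_target_mem_nhds q)).differentiableAt (by simp)

end Smooth

/-! ## The covariant derivative in a fixed chart -/

section FixedChart

variable {E : Type*} [NormedAddCommGroup E] [NormedSpace ℝ E]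
  {N : Type*} [TopologicalSpace N] [ChartedSpace E N] [IsManifold 𝓘(ℝ, E) ∞ N]
  {F : Type*} [NormedAddCommGroup F] [NormedSpace ℝ F]
  {M : Type*} [TopologicalSpace M] [ChartedSpace F M]

/-- Only the germ of the metric enters. This matters because the pull-back of a metric through a
chart agrees with the original only on the chart domain. -/
theorem christoffel_congr {g g' : FormField E N} {q : N} (h : ∀ᶠ q' in 𝓝 q, g q' = g' q')
    (u v : TangentSpace 𝓘(ℝ, E) q) : christoffel g q u v = christoffel g' q u v := by
  have h1 : chartForm g q =ᶠ[𝓝 (extChartAt 𝓘(ℝ, E) q q)] chartForm g' q := by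
    filter_upwards [(tendsto_extChartAt_symm (F := E) q).eventually h] with z hz
    ext a b
    rw [chartForm_apply, chartForm_apply, hz]
  have h2 : formAt g q = formAt g' q := h.self_of_nhds
  have h3 : koszulCovector (chartForm g q) (extChartAt 𝓘(ℝ, E) q q) =
      koszulCovector (chartForm g' q) (extChartAt 𝓘(ℝ, E) q q) := by
    funext u v
    have e1 : ∀ v, fderiv ℝ (fun z ↦ chartForm g q z v) (extChartAt 𝓘(ℝ, E) q q) =
        fderiv ℝ (fun z ↦ chartForm g' q z v) (extChartAt 𝓘(ℝ, E) q q) := fun v ↦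
      Filter.EventuallyEq.fderiv_eq (h1.mono fun z hz ↦ by simp only [hz])
    have e2 : fderiv ℝ (fun z ↦ chartForm g q z u v) (extChartAt 𝓘(ℝ, E) q q) =
        fderiv ℝ (fun z ↦ chartForm g' q z u v) (extChartAt 𝓘(ℝ, E) q q) :=
      Filter.EventuallyEq.fderiv_eq (h1.mono fun z hz ↦ by simp only [hz])
    simp only [koszulCovector, e1, e2]
  exact (christoffel_eq g q u v).trans
    ((by rw [h2, h3] : _ = (formAt g' q).inverse (koszulCovector (E := E) (chartForm g' q)
      (extChartAt 𝓘(ℝ, E) q q) u v)).trans (christoffel_eq g' q u v).symm)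

/-- A field of forms on the model space, as a field of forms on the tangent spaces. -/
def modelForm (G : E → E →L[ℝ] E →L[ℝ] ℝ) : FormField E E := G

theorem chartForm_modelForm (G : E → E →L[ℝ] E →L[ℝ] ℝ) (y : E) :
    chartForm (modelForm G) y = G := by
  funext z
  ext a b
  have h : ∀ a : E, ofCoord (N := E) y ((extChartAt 𝓘(ℝ, E) y).symm z) a = a := by
    intro a
    rw [← coord_model y (ofCoord (N := E) y ((extChartAt 𝓘(ℝ, E) y).symm z) a)]
    exact coord_ofCoord (by rw [extChartAt_model_space_eq_id]; exact Set.mem_univ _) a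
  have h' : (extChartAt 𝓘(ℝ, E) y).symm z = z := by rw [extChartAt_model_space_eq_id]; rfl
  rw [chartForm_apply, h, h]
  exact congrArg (fun z ↦ G z a b) h'

variable {g : FormField E N} {φ : M → N} {s : ∀ p : M, TangentSpace 𝓘(ℝ, E) (φ p)} {p : M} {q₀ : N}

theorem inducedMetric_extChartAt (g : FormField E N) {q : N}
    (hq : q ∈ (extChartAt 𝓘(ℝ, E) q₀).source) :
    inducedMetric (modelForm (chartForm g q₀)) (extChartAt 𝓘(ℝ, E) q₀) q = g q := by
  ext u w
  have h := chartForm_coord g hq u w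
  rw [coord_eq_mfderiv hq, coord_eq_mfderiv hq] at h
  exact h

theorem isRegularAt_modelForm [FiniteDimensional ℝ E]
    (hsm : ContDiffOn ℝ ∞ (chartForm g q₀) (extChartAt 𝓘(ℝ, E) q₀).target)
    (hs : ∀ (q : N) (v w : TangentSpace 𝓘(ℝ, E) q), g q v w = g q w v)
    (hpos : ∀ (q : N) (v : TangentSpace 𝓘(ℝ, E) q), v ≠ 0 → 0 < g q v v) {y : E}
    (hy : y ∈ (extChartAt 𝓘(ℝ, E) q₀).target) :
    IsRegularAt (modelForm (chartForm g q₀)) y where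
  symm z _ _ := chartForm_symm hs q₀ z _ _
  invertible := by
    refine isInvertible_of_pos fun a ha ↦ ?_
    refine hpos _ (ofCoord q₀ ((extChartAt 𝓘(ℝ, E) q₀).symm y) a) fun h0 ↦ ha ?_
    have hq := (extChartAt 𝓘(ℝ, E) q₀).map_target hy
    rw [← coord_ofCoord hq a, h0]
    have h1 := coord_smul hq 0 (0 : TangentSpace 𝓘(ℝ, E) ((extChartAt 𝓘(ℝ, E) q₀).symm y))
    rwa [zero_smul, zero_smul] at h1
  differentiableAt := by
    rw [chartForm_modelForm, extChartAt_model_space_eq_id]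
    exact (hsm.contDiffAt (extChartAt_target_mem_nhds' hy)).differentiableAt (by simp)

/-- `covAlong` uses a different chart at each point, so its dependence on the point is hidden. The
chart `ψ` at `q₀` is a local isometry onto the model space with the form `chartForm g q₀`; by
`covAlong_differential` it carries covariant derivatives to covariant derivatives up to a Gauss
term, which vanishes when paired with an image vector `dψ(w)`. -/
theorem metric_covAlong_chart [FiniteDimensional ℝ E]
    (hsm : ContDiffOn ℝ ∞ (chartForm g q₀) (extChartAt 𝓘(ℝ, E) q₀).target)
    (hs : ∀ (q : N) (v w : TangentSpace 𝓘(ℝ, E) q), g q v w = g q w v)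
    (hpos : ∀ (q : N) (v : TangentSpace 𝓘(ℝ, E) q), v ≠ 0 → 0 < g q v v)
    (hp : φ p ∈ (extChartAt 𝓘(ℝ, E) q₀).source) (hd : DiffAlongAt (F := F) φ s p)
    (v : TangentSpace 𝓘(ℝ, F) p) (w : TangentSpace 𝓘(ℝ, E) (φ p)) :
    g (φ p) (covAlong g φ s p v) w =
      chartForm g q₀ (extChartAt 𝓘(ℝ, E) q₀ (φ p))
        (mvfderiv 𝓘(ℝ, F) (fun p' ↦ coord q₀ (s p')) p v) (coord q₀ w)
      + koszulCovector (chartForm g q₀) (extChartAt 𝓘(ℝ, E) q₀ (φ p))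
        (coord q₀ (differential E F φ p v)) (coord q₀ (s p)) (coord q₀ w) := by
  set ψ := extChartAt 𝓘(ℝ, E) q₀ with hψ
  set G := modelForm (chartForm g q₀) with hG
  have hy : ψ (φ p) ∈ ψ.target := ψ.map_source hp
  have hGr : IsRegularAt G (ψ (φ p)) := isRegularAt_modelForm hsm hs hpos hy
  have hev : ∀ᶠ q in 𝓝 (φ p), inducedMetric G ψ q = g q := by
    filter_upwards [extChartAt_source_mem_nhds' (I := 𝓘(ℝ, E)) hp] with q hq
    exact inducedMetric_extChartAt g hq
  have hi : (formAt (inducedMetric (F := E) G ψ) (φ p)).IsInvertible := by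
    have : formAt (inducedMetric (F := E) G ψ) (φ p) = formAt g (φ p) := hev.self_of_nhds
    rw [this]
    exact isInvertible_of_pos (hpos (φ p))
  have hψs : ContMDiffAt 𝓘(ℝ, E) 𝓘(ℝ, E) 2 ψ (φ p) :=
    (contMDiffAt_extChartAt' (n := ∞) (by rwa [hψ, extChartAt_source] at hp)).of_le
      ENat.LEInfty.out
  have h1 := covAlong_differential G hψs hd v
  have h2 : covAlong (inducedMetric G ψ) φ s p v = covAlong g φ s p v := by
    rw [covAlong_eq, covAlong_eq, christoffel_congr hev]
  rw [h2] at h1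
  have h3 := metric_gaussForm hGr hi hψs (differential E F φ p v) (s p) w
  have h4 : G (ψ (φ p)) (differential E E ψ (φ p) (covAlong g φ s p v))
      (differential E E ψ (φ p) w) = g (φ p) (covAlong g φ s p v) w :=
    congrArg (fun B : E →L[ℝ] E →L[ℝ] ℝ ↦ B (covAlong g φ s p v) w) hev.self_of_nhds
  rw [← h4]
  have h5 : G (ψ (φ p)) (differential E E ψ (φ p) (covAlong g φ s p v))
      (differential E E ψ (φ p) w) = G (ψ (φ p)) (covAlong G (fun p' ↦ ψ (φ p'))
        (fun p' ↦ differential E E ψ (φ p') (s p')) p v) (differential E E ψ (φ p) w) := by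
    rw [h1, map_add, add_apply, h3, add_zero]
  rw [h5, covAlong_eq, map_add, add_apply, metric_christoffel hGr]
  have hcd : ∀ {q : N} (_ : q ∈ ψ.source) (u : TangentSpace 𝓘(ℝ, E) q),
      differential E E ψ q u = coord q₀ u := fun hq u ↦ (coord_eq_mfderiv hq u).symm
  have hc : differential E F (fun p' ↦ ψ (φ p')) p v =
      differential E E ψ (φ p) (differential E F φ p v) := by
    have := mfderiv_comp (g := ψ) (f := φ) p (hψs.mdifferentiableAt (by norm_num))
      (diffAlongAt_iff.1 hd).1
    exact congrArg (fun L : F →L[ℝ] E ↦ L v) this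
  have h6 : (fun p' ↦ coord (ψ (φ p)) (differential E E ψ (φ p') (s p'))) =ᶠ[𝓝 p]
      fun p' ↦ coord q₀ (s p') := by
    filter_upwards [(diffAlongAt_iff.1 hd).1.continuousAt.preimage_mem_nhds
      (extChartAt_source_mem_nhds' (I := 𝓘(ℝ, E)) hp)] with p' hp'
    rw [coord_model]
    exact hcd hp' _
  have h7 : derivCoord (fun p' ↦ ψ (φ p')) (fun p' ↦ differential E E ψ (φ p') (s p')) p v =
      mvfderiv 𝓘(ℝ, F) (fun p' ↦ coord q₀ (s p')) p v :=
    congrArg (fun L : F →L[ℝ] E ↦ L v) h6.mfderiv_eq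
  rw [h7, hc, hcd hp, hcd hp, hcd hp, chartForm_modelForm, extChartAt_model_space_eq_id]
  rfl

/-- In the fixed chart at `φ p` the pairing is a polynomial in the metric coefficients, their
derivatives, and the coordinates of the fields and their derivatives, all smooth near `p`. -/
theorem contMDiffAt_metric_covAlong [FiniteDimensional ℝ E] [IsManifold 𝓘(ℝ, F) ∞ M]
    (hsm : ∀ q, SmoothFormAt g q)
    (hs : ∀ (q : N) (v w : TangentSpace 𝓘(ℝ, E) q), g q v w = g q w v)
    (hpos : ∀ (q : N) (v : TangentSpace 𝓘(ℝ, E) q), v ≠ 0 → 0 < g q v v)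
    {V : VField F M} {t : ∀ p : M, TangentSpace 𝓘(ℝ, E) (φ p)}
    (hV : SmoothAlongAt (F := F) (fun p : M ↦ p) V p)
    (hsp : SmoothAlongAt (F := F) φ s p) (htp : SmoothAlongAt (F := F) φ t p) :
    ContMDiffAt 𝓘(ℝ, F) 𝓘(ℝ, ℝ) ∞
      (fun p' ↦ g (φ p') (covAlong g φ s p' (V p')) (t p')) p := by
  have hq := mem_extChartAt_source (I := 𝓘(ℝ, E)) (φ p)
  have hφ := hsp.contMDiffAt
  have hG := contDiffOn_chartForm hsm (φ p)
  set G := chartForm g (φ p)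
  have hGp : ContDiffAt ℝ ∞ G (extChartAt 𝓘(ℝ, E) (φ p) (φ p)) :=
    hG.contDiffAt (extChartAt_target_mem_nhds (φ p))
  have hy : ContMDiffAt 𝓘(ℝ, F) 𝓘(ℝ, E) ∞ (fun p' ↦ extChartAt 𝓘(ℝ, E) (φ p) (φ p')) p :=
    ContMDiffAt.comp (g := extChartAt 𝓘(ℝ, E) (φ p)) (f := φ) p contMDiffAt_extChartAt hφ
  have hGφ : ContMDiffAt 𝓘(ℝ, F) 𝓘(ℝ, E →L[ℝ] E →L[ℝ] ℝ) ∞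
      (fun p' ↦ G (extChartAt 𝓘(ℝ, E) (φ p) (φ p'))) p :=
    ContMDiffAt.comp (g := G) p hGp.contMDiffAt hy
  have hDφ : ContMDiffAt 𝓘(ℝ, F) 𝓘(ℝ, E →L[ℝ] E →L[ℝ] E →L[ℝ] ℝ) ∞
      (fun p' ↦ fderiv ℝ G (extChartAt 𝓘(ℝ, E) (φ p) (φ p'))) p :=
    ContMDiffAt.comp (g := fderiv ℝ G) p (hGp.fderiv_right (m := ∞) (by simp)).contMDiffAt hy
  have hu := ((smoothAlongAt_iff hq).1 (smoothAlongAt_differential hφ hV)).2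
  have hsc := ((smoothAlongAt_iff hq).1 hsp).2
  have htc := ((smoothAlongAt_iff hq).1 htp).2
  have hds := contMDiffAt_mvfderiv hsc hV
  have htot := ((hGφ.clm_apply hds).clm_apply htc).add
    ((contMDiffAt_const (c := (2⁻¹ : ℝ))).mul
      (((((hDφ.clm_apply hu).clm_apply hsc).clm_apply htc).add
        (((hDφ.clm_apply hsc).clm_apply hu).clm_apply htc)).sub
        (((hDφ.clm_apply htc).clm_apply hu).clm_apply hsc)))
  refine htot.congr_of_eventuallyEq ?_
  filter_upwards [hsp.eventually,
    eventually_mem_source (hφ.mdifferentiableAt (by simp))] with p' h1 h2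
  have h3 : DifferentiableAt ℝ G (extChartAt 𝓘(ℝ, E) (φ p) (φ p')) :=
    (hG.contDiffAt (extChartAt_target_mem_nhds'
      ((extChartAt 𝓘(ℝ, E) (φ p)).map_source h2))).differentiableAt (by simp)
  rw [metric_covAlong_chart hG hs hpos h2 h1, koszulCovector_apply h3]
  rfl

end FixedChart

/-! ## Parallel endomorphisms along maps -/

section Parallel

variable {E : Type*} [NormedAddCommGroup E] [NormedSpace ℝ E]
  {N : Type*} [TopologicalSpace N] [ChartedSpace E N] [IsManifold 𝓘(ℝ, E) ∞ N]
  {F : Type*} [NormedAddCommGroup F] [NormedSpace ℝ F]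
  {M : Type*} [TopologicalSpace M] [ChartedSpace F M]
  {g : FormField E N} {φ : M → N} {p : M}

theorem covAlong_comp {X : VField E N} (hX : DiffAlongAt (F := E) (fun q : N ↦ q) X (φ p))
    (hφ : MDifferentiableAt 𝓘(ℝ, F) 𝓘(ℝ, E) φ p) (v : TangentSpace 𝓘(ℝ, F) p) :
    covAlong g φ (fun p' ↦ X (φ p')) p v = leviCivita g X (φ p) (differential E F φ p v) := by
  have h1 : derivCoord φ (fun p' ↦ X (φ p')) p v =
      derivCoord (fun q : N ↦ q) X (φ p) (differential E F φ p v) := by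
    have := mfderiv_comp (g := fun q ↦ coord (φ p) (X q)) (f := φ) p (diffAlongAt_iff.1 hX).2 hφ
    exact congrArg (fun L : F →L[ℝ] E ↦ L v) this
  have h2 : differential E E (fun q : N ↦ q) (φ p) (differential E F φ p v) =
      differential E F φ p v :=
    congrArg (fun L : E →L[ℝ] E ↦ L (differential E F φ p v))
      (mfderiv_id (I := 𝓘(ℝ, E)) (x := φ p))
  rw [leviCivita, covAlong_eq, covAlong_eq, h1, h2]

theorem covAlong_sum {ι : Type*} (S : Finset ι) {a : ι → M → ℝ}
    {t : ι → ∀ p : M, TangentSpace 𝓘(ℝ, E) (φ p)} (hg : IsRegularAt g (φ p))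
    (hφ : MDifferentiableAt 𝓘(ℝ, F) 𝓘(ℝ, E) φ p)
    (ha : ∀ i, MDifferentiableAt 𝓘(ℝ, F) 𝓘(ℝ, ℝ) (a i) p)
    (ht : ∀ i, DiffAlongAt (F := F) φ (t i) p) :
    DiffAlongAt (F := F) φ (fun p' ↦ ∑ i ∈ S, a i p' • t i p') p ∧
    ∀ v : TangentSpace 𝓘(ℝ, F) p, covAlong g φ (fun p' ↦ ∑ i ∈ S, a i p' • t i p') p v =
      ∑ i ∈ S, (a i p • covAlong g φ (t i) p v + mvfderiv 𝓘(ℝ, F) (a i) p v • t i p) := by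
  classical
  induction S using Finset.induction_on with
  | empty =>
    simp only [Finset.sum_empty]
    refine ⟨diffAlongAt_iff.2 ⟨hφ, ?_⟩, covAlong_zero hg hφ⟩
    refine (mdifferentiableAt_const (c := (0 : E))).congr_of_eventuallyEq ?_
    filter_upwards [eventually_mem_source hφ] with p' hp'
    have := coord_smul hp' 0 (0 : TangentSpace 𝓘(ℝ, E) (φ p'))
    rwa [zero_smul, zero_smul] at this
  | insert i S hi ih =>
    simp only [Finset.sum_insert hi]
    refine ⟨((ht i).smul (ha i)).add ih.1, fun v ↦ ?_⟩
    rw [covAlong_add hg ((ht i).smul (ha i)) ih.1, ih.2, covAlong_smul hg (ha i) (ht i)]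

/-- A parallel field of endomorphisms commutes with the covariant derivative along a map. -/
theorem covAlong_endomorphism [FiniteDimensional ℝ E] [T2Space N]
    {J : ∀ q : N, TangentSpace 𝓘(ℝ, E) q →L[ℝ] TangentSpace 𝓘(ℝ, E) q}
    (hJ : ∀ X : VField E N, SmoothField X → SmoothField (fun q ↦ J q (X q)))
    (hpar : ∀ X : VField E N, SmoothField X → ∀ (q : N) (v : TangentSpace 𝓘(ℝ, E) q),
      leviCivita g (fun q' ↦ J q' (X q')) q v = J q (leviCivita g X q v))
    {s : ∀ p : M, TangentSpace 𝓘(ℝ, E) (φ p)} (hg : IsRegularAt g (φ p))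
    (hs : DiffAlongAt (F := F) φ s p) :
    DiffAlongAt (F := F) φ (fun p' ↦ J (φ p') (s p')) p ∧
    ∀ v : TangentSpace 𝓘(ℝ, F) p,
      covAlong g φ (fun p' ↦ J (φ p') (s p')) p v = J (φ p) (covAlong g φ s p v) := by
  have hφ := (diffAlongAt_iff.1 hs).1
  -- Parallelism of `J` is known only for fields on `N`. Near `p`, `s` is therefore written as a
  -- combination of restricted ambient fields `X i`, with the coordinates `a i` of `s` as
  -- coefficients.
  let b := Module.finBasis ℝ E
  choose X hX hXe using fun i ↦ exists_smoothField (φ p) (b i)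
  let a : Fin (Module.finrank ℝ E) → M → ℝ := fun i p' ↦ b.coord i (coord (φ p) (s p'))
  have ha : ∀ i, MDifferentiableAt 𝓘(ℝ, F) 𝓘(ℝ, ℝ) (a i) p := by
    intro i
    exact (b.coord i).toContinuousLinearMap.differentiableAt.comp_mdifferentiableAt
      (diffAlongAt_iff.1 hs).2
  have hsum : ∀ᶠ p' in 𝓝 p, s p' = ∑ i, a i p' • X i (φ p') := by
    have h1 : ∀ᶠ p' in 𝓝 p, ∀ i, X i (φ p') = ofCoord (φ p) (φ p') (b i) :=
      Filter.eventually_all.2 fun i ↦ hφ.continuousAt.eventually (hXe i)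
    filter_upwards [h1, eventually_mem_source hφ] with p' h2 h3
    simp only [h2, a]
    have h4 : s p' = ofCoord (φ p) (φ p') (∑ i, b.coord i (coord (φ p) (s p')) • b i) := by
      simp only [Module.Basis.coord_apply, b.sum_repr, ofCoord_coord h3]
    refine h4.trans ?_
    simp only [ofCoord, map_sum, map_smul]
  have hJsum : ∀ᶠ p' in 𝓝 p, J (φ p') (s p') = ∑ i, a i p' • J (φ p') (X i (φ p')) := by
    filter_upwards [hsum] with p' hp'
    rw [hp']
    simp only [map_sum, map_smul]
  have hXd : ∀ i, DiffAlongAt (F := F) φ (fun p' ↦ X i (φ p')) p := fun i ↦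
    MDifferentiableAt.comp (f := φ) p ((hX i).mdifferentiableAt (by simp)) hφ
  have hJXd : ∀ i, DiffAlongAt (F := F) φ (fun p' ↦ J (φ p') (X i (φ p'))) p := fun i ↦
    MDifferentiableAt.comp (f := φ) p ((hJ _ (hX i)).mdifferentiableAt (by simp)) hφ
  have k1 := covAlong_sum Finset.univ hg hφ ha hXd
  have k2 := covAlong_sum Finset.univ hg hφ ha hJXd
  refine ⟨k2.1.congr hJsum, fun v ↦ ?_⟩
  rw [covAlong_congr hJsum, covAlong_congr hsum, k1.2, k2.2, map_sum]
  refine Finset.sum_congr rfl fun i _ ↦ ?_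
  rw [map_add, map_smul, map_smul,
    covAlong_comp (X := X i) ((hX i).mdifferentiableAt (by simp)) hφ,
    covAlong_comp (X := fun q ↦ J q (X i q)) ((hJ _ (hX i)).mdifferentiableAt (by simp)) hφ,
    hpar _ (hX i)]

end Parallel

/-! ## Immersed submanifolds -/

section Immersion

variable {E : Type*} [NormedAddCommGroup E] [NormedSpace ℝ E]
  {N : Type*} [TopologicalSpace N] [ChartedSpace E N] [IsManifold 𝓘(ℝ, E) ∞ N]
  {F : Type*} [NormedAddCommGroup F] [NormedSpace ℝ F] [FiniteDimensional ℝ F]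
  {M : Type*} [TopologicalSpace M] [ChartedSpace F M] [IsManifold 𝓘(ℝ, F) ∞ M]
  {g : FormField E N} {φ : M → N}

omit [IsManifold 𝓘(ℝ, E) ∞ N] [FiniteDimensional ℝ F] [IsManifold 𝓘(ℝ, F) ∞ M] in
theorem inducedMetric_apply (g : FormField E N) (φ : M → N) (p : M)
    (v w : TangentSpace 𝓘(ℝ, F) p) :
    inducedMetric g φ p v w = g (φ p) (differential E F φ p v) (differential E F φ p w) :=
  rfl

/-- A positive definite metric on the target of an immersion. -/
structure IsRiemannianImmersion (F : Type*) [NormedAddCommGroup F] [NormedSpace ℝ F]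
    {M : Type*} [TopologicalSpace M] [ChartedSpace F M] (g : FormField E N) (φ : M → N) :
    Prop where
  smooth : ∀ q, SmoothFormAt g q
  regular : ∀ q, IsRegularAt g q
  pos : ∀ (q : N) (v : TangentSpace 𝓘(ℝ, E) q), v ≠ 0 → 0 < g q v v
  immersion : IsSmoothImmersion E F φ

namespace IsRiemannianImmersion

omit [FiniteDimensional ℝ F] [IsManifold 𝓘(ℝ, F) ∞ M] in
theorem induced_pos (h : IsRiemannianImmersion F g φ) (p : M) (v : TangentSpace 𝓘(ℝ, F) p)
    (hv : v ≠ 0) : 0 < inducedMetric g φ p v v := by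
  refine h.pos (φ p) _ fun h0 ↦ hv (h.immersion.2 p ?_)
  exact h0.trans (map_zero _).symm

omit [FiniteDimensional ℝ F] [IsManifold 𝓘(ℝ, F) ∞ M] in
theorem induced_symm (h : IsRiemannianImmersion F g φ) (p : M) (v w : TangentSpace 𝓘(ℝ, F) p) :
    inducedMetric g φ p v w = inducedMetric g φ p w v :=
  (h.regular (φ p)).symm _ _ _

omit [IsManifold 𝓘(ℝ, F) ∞ M] in
theorem induced_invertible (h : IsRiemannianImmersion F g φ) (p : M) :
    (formAt (inducedMetric (F := F) g φ) p).IsInvertible :=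
  isInvertible_of_pos (h.induced_pos p)

omit [FiniteDimensional ℝ F] [IsManifold 𝓘(ℝ, F) ∞ M] in
theorem contMDiffAt_two (h : IsRiemannianImmersion F g φ) (p : M) :
    ContMDiffAt 𝓘(ℝ, F) 𝓘(ℝ, E) 2 φ p :=
  (h.immersion.1 p).of_le ENat.LEInfty.out

theorem induced_regular (h : IsRiemannianImmersion F g φ) (p : M) :
    IsRegularAt (inducedMetric (F := F) g φ) p :=
  (h.regular (φ p)).induced (h.contMDiffAt_two p) (h.induced_invertible p)

omit [FiniteDimensional ℝ F] [IsManifold 𝓘(ℝ, F) ∞ M] in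
theorem eq_zero_of_induced (h : IsRiemannianImmersion F g φ) {p : M}
    {v : TangentSpace 𝓘(ℝ, F) p} (hv : ∀ w, inducedMetric g φ p v w = 0) : v = 0 := by
  by_contra h0
  exact (h.induced_pos p v h0).ne' (hv v)

omit [IsManifold 𝓘(ℝ, F) ∞ M] in
theorem metric_tangentPart (h : IsRiemannianImmersion F g φ) (p : M)
    (u : TangentSpace 𝓘(ℝ, E) (φ p)) (w : TangentSpace 𝓘(ℝ, F) p) :
    inducedMetric g φ p (tangentPart F g φ p u) w = g (φ p) u (differential E F φ p w) :=
  congrArg (fun L : F →L[ℝ] ℝ ↦ L w) (apply_inverse_of_isInvertible (h.induced_invertible p)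
    ((g (φ p) u).comp (differential E F φ p)))

omit [IsManifold 𝓘(ℝ, F) ∞ M] in
-- The induced metric is definite, so a splitting into a tangent and a normal vector is unique.
-- Later tangential and normal parts are found by exhibiting such a splitting.
theorem tangentPart_eq (h : IsRiemannianImmersion F g φ) {p : M}
    {u n : TangentSpace 𝓘(ℝ, E) (φ p)} {t : TangentSpace 𝓘(ℝ, F) p}
    (hu : u = differential E F φ p t + n)
    (hn : ∀ w : TangentSpace 𝓘(ℝ, F) p, g (φ p) n (differential E F φ p w) = 0) :
    tangentPart F g φ p u = t := by
  rw [← sub_eq_zero]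
  refine h.eq_zero_of_induced fun w ↦ ?_
  rw [map_sub, sub_apply, h.metric_tangentPart, inducedMetric_apply, hu, map_add, add_apply, hn,
    add_zero, sub_self]

omit [IsManifold 𝓘(ℝ, F) ∞ M] in
theorem normalPart_eq (h : IsRiemannianImmersion F g φ) {p : M}
    {u n : TangentSpace 𝓘(ℝ, E) (φ p)} {t : TangentSpace 𝓘(ℝ, F) p}
    (hu : u = differential E F φ p t + n)
    (hn : ∀ w : TangentSpace 𝓘(ℝ, F) p, g (φ p) n (differential E F φ p w) = 0) :
    normalPart F g φ p u = n := by
  rw [normalPart, h.tangentPart_eq hu hn, hu, add_sub_cancel_left]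

omit [IsManifold 𝓘(ℝ, F) ∞ M] in
theorem metric_normalPart (h : IsRiemannianImmersion F g φ) (p : M)
    (u : TangentSpace 𝓘(ℝ, E) (φ p)) (w : TangentSpace 𝓘(ℝ, F) p) :
    g (φ p) (normalPart F g φ p u) (differential E F φ p w) = 0 := by
  rw [normalPart, map_sub, sub_apply, ← h.metric_tangentPart, inducedMetric_apply, sub_self]

omit [FiniteDimensional ℝ F] in
/-- The Gauss formula. -/
theorem gauss_formula (h : IsRiemannianImmersion F g φ) {p : M} {Y : VField F M}
    (hY : DiffAlongAt (F := F) (fun p : M ↦ p) Y p) (v : TangentSpace 𝓘(ℝ, F) p) :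
    covAlong g φ (fun p' ↦ differential E F φ p' (Y p')) p v =
      differential E F φ p (leviCivita (inducedMetric g φ) Y p v)
        + gaussForm F g φ p v (Y p) := by
  have h1 := covAlong_differential (φ := fun p : M ↦ p) g (h.contMDiffAt_two p) hY v
  have h2 : differential F F (fun p : M ↦ p) p v = v :=
    congrArg (fun L : F →L[ℝ] F ↦ L v) (mfderiv_id (I := 𝓘(ℝ, F)) (x := p))
  rw [h2] at h1
  exact h1

theorem metric_gaussForm (h : IsRiemannianImmersion F g φ) {p : M}
    (u v w : TangentSpace 𝓘(ℝ, F) p) :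
    g (φ p) (gaussForm F g φ p u v) (differential E F φ p w) = 0 :=
  TotallyReal.metric_gaussForm (h.regular _) (h.induced_invertible p) (h.contMDiffAt_two p) u v w

/-- The Gauss formula, applied to the chosen extension of `w`, leaves a normal term depending only
on the value at `p`. -/
theorem secondFundamentalForm_eq (h : IsRiemannianImmersion F g φ) (p : M)
    (v w : TangentSpace 𝓘(ℝ, F) p) :
    secondFundamentalForm g φ p v w = gaussForm F g φ p v w := by
  have hd : DiffAlongAt (F := F) (fun p : M ↦ p) (fun p' : M ↦ FiberBundle.extend F w p') p :=
    FiberBundle.mdifferentiableAt_extend 𝓘(ℝ, F) F w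
  refine h.normalPart_eq
    (t := leviCivita (inducedMetric g φ) (fun p' : M ↦ FiberBundle.extend F w p') p v) ?_
    fun w' ↦ h.metric_gaussForm v w w'
  rw [h.gauss_formula hd, FiberBundle.extend_apply_self]

/-- The induced connection is metric. -/
theorem mvfderiv_induced (h : IsRiemannianImmersion F g φ) {p : M} {Y Z : VField F M}
    (hY : DiffAlongAt (F := F) (fun p : M ↦ p) Y p)
    (hZ : DiffAlongAt (F := F) (fun p : M ↦ p) Z p) (v : TangentSpace 𝓘(ℝ, F) p) :
    mvfderiv 𝓘(ℝ, F) (fun p' ↦ inducedMetric g φ p' (Y p') (Z p')) p v =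
      inducedMetric g φ p (leviCivita (inducedMetric g φ) Y p v) (Z p)
        + inducedMetric g φ p (Y p) (leviCivita (inducedMetric g φ) Z p v) :=
  (mvfderiv_metric (φ := fun p : M ↦ p) (h.induced_regular p) hY hZ).2 v

omit [FiniteDimensional ℝ F] in
theorem contMDiffAt_induced (h : IsRiemannianImmersion F g φ) {p : M} {Y Z : VField F M}
    (hY : SmoothAlongAt (F := F) (fun p : M ↦ p) Y p)
    (hZ : SmoothAlongAt (F := F) (fun p : M ↦ p) Z p) :
    ContMDiffAt 𝓘(ℝ, F) 𝓘(ℝ, ℝ) ∞ (fun p' ↦ inducedMetric g φ p' (Y p') (Z p')) p :=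
  contMDiffAt_form (g := g) (φ := φ) (h.smooth (φ p)) (smoothAlongAt_differential (h.immersion.1 p) hY)
    (smoothAlongAt_differential (h.immersion.1 p) hZ)

end IsRiemannianImmersion

/-! ### Orthonormal frames on surfaces -/

theorem eq_add_of_orthonormal {B : F →L[ℝ] F →L[ℝ] ℝ} (hF : Module.finrank ℝ F = 2)
    (hs : ∀ v w, B v w = B w v) {e₁ e₂ : F} (h₁ : B e₁ e₁ = 1) (h₂ : B e₂ e₂ = 1)
    (h₁₂ : B e₁ e₂ = 0) (w : F) : w = B w e₁ • e₁ + B w e₂ • e₂ := by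
  have hli : LinearIndependent ℝ ![e₁, e₂] := by
    rw [LinearIndependent.pair_iff]
    intro a b hab
    have k1 := congrArg (fun u ↦ B u e₁) hab
    have k2 := congrArg (fun u ↦ B u e₂) hab
    simp only [map_add, map_smul, add_apply, smul_apply, smul_eq_mul, map_zero, zero_apply,
      h₁, h₂, h₁₂, hs e₂ e₁] at k1 k2
    constructor <;> linarith
  have htop := hli.span_eq_top_of_card_eq_finrank' (by simp [hF])
  have hw : w ∈ Submodule.span ℝ (Set.range ![e₁, e₂]) := htop ▸ Submodule.mem_top
  rw [Matrix.range_cons, Matrix.range_cons, Matrix.range_empty, Set.union_empty,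
    Set.singleton_union, Submodule.mem_span_pair] at hw
  obtain ⟨a, b, rfl⟩ := hw
  simp only [map_add, map_smul, add_apply, smul_apply, smul_eq_mul, h₁, h₂, h₁₂, hs e₂ e₁]
  simp

omit [FiniteDimensional ℝ F] in
theorem exists_forall_smul_add_smul_eq_zero (hF : Module.finrank ℝ F = 2) {x : F} (hx : x ≠ 0) :
    ∃ y : F, ∀ a b : ℝ, a • x + b • y = 0 → a = 0 ∧ b = 0 := by
  obtain ⟨y, hy⟩ := exists_linearIndependent_pair_of_one_lt_finrank
    (by rw [hF]; norm_num : 1 < Module.finrank ℝ F) hx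
  exact ⟨y, LinearIndependent.pair_iff.1 hy⟩

/-- The metric trace does not depend on the basis: the vector dual to the `i`-th coordinate has
components `b.repr e₁ i` and `b.repr e₂ i` in the orthonormal basis, and summing over `i`
reassembles `e₁` and `e₂`. -/
theorem sum_apply_inverse_coord {B : F →L[ℝ] F →L[ℝ] ℝ} (hF : Module.finrank ℝ F = 2)
    (hs : ∀ v w, B v w = B w v) (hB : B.IsInvertible) {e₁ e₂ : F} (h₁ : B e₁ e₁ = 1)
    (h₂ : B e₂ e₂ = 1) (h₁₂ : B e₁ e₂ = 0) {V : Type*} [AddCommGroup V] [Module ℝ V]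
    (S : F →ₗ[ℝ] F →ₗ[ℝ] V) {ι : Type*} [Fintype ι] (b : Module.Basis ι ℝ F) :
    ∑ i, S (b i) (B.inverse (b.coord i).toContinuousLinearMap) = S e₁ e₁ + S e₂ e₂ := by
  have h : ∀ i, B.inverse (b.coord i).toContinuousLinearMap =
      b.repr e₁ i • e₁ + b.repr e₂ i • e₂ := by
    intro i
    rw [eq_add_of_orthonormal hF hs h₁ h₂ h₁₂ (B.inverse (b.coord i).toContinuousLinearMap),
      apply_inverse_of_isInvertible hB]
    rfl
  have h' : ∀ e : F, ∑ i, b.repr e i • S (b i) e = S e e := by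
    intro e
    have := congrArg (fun u ↦ S u e) (b.sum_repr e)
    simpa only [map_sum, map_smul, LinearMap.sum_apply, LinearMap.smul_apply] using this
  simp only [h, map_add, map_smul, Finset.sum_add_distrib, h']

/-- Vector fields that form an orthonormal frame near `p`. -/
structure IsOrthonormalFrameAt (γ : FormField F M) (p : M) (e₁ e₂ : VField F M) : Prop where
  smooth₁ : SmoothAlongAt (F := F) (fun p : M ↦ p) e₁ p
  smooth₂ : SmoothAlongAt (F := F) (fun p : M ↦ p) e₂ p
  unit₁ : ∀ᶠ p' in 𝓝 p, γ p' (e₁ p') (e₁ p') = 1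
  unit₂ : ∀ᶠ p' in 𝓝 p, γ p' (e₂ p') (e₂ p') = 1
  orthogonal : ∀ᶠ p' in 𝓝 p, γ p' (e₁ p') (e₂ p') = 0

omit [FiniteDimensional ℝ F] in
theorem IsRiemannianImmersion.normalize (h : IsRiemannianImmersion F g φ) {p : M} {X : VField F M}
    (hX : SmoothAlongAt (F := F) (fun p : M ↦ p) X p) (hX0 : X p ≠ 0) :
    SmoothAlongAt (F := F) (fun p : M ↦ p)
      (fun p' ↦ (Real.sqrt (inducedMetric g φ p' (X p') (X p')))⁻¹ • X p') p ∧
    ∀ᶠ p' in 𝓝 p, inducedMetric g φ p'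
      ((Real.sqrt (inducedMetric g φ p' (X p') (X p')))⁻¹ • X p')
      ((Real.sqrt (inducedMetric g φ p' (X p') (X p')))⁻¹ • X p') = 1 := by
  have hsm := h.contMDiffAt_induced hX hX
  have hpos := h.induced_pos p _ hX0
  have hr : ContMDiffAt 𝓘(ℝ, F) 𝓘(ℝ, ℝ) ∞
      (fun p' ↦ (Real.sqrt (inducedMetric g φ p' (X p') (X p')))⁻¹) p := by
    have h1 : ContDiffAt ℝ ∞ (fun x : ℝ ↦ (Real.sqrt x)⁻¹) (inducedMetric g φ p (X p) (X p)) :=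
      (Real.contDiffAt_sqrt hpos.ne').inv (Real.sqrt_pos.2 hpos).ne'
    exact ContMDiffAt.comp (g := fun x : ℝ ↦ (Real.sqrt x)⁻¹) p h1.contMDiffAt hsm
  refine ⟨hX.smul hr, ?_⟩
  filter_upwards [hsm.continuousAt.eventually (lt_mem_nhds hpos)] with p' hp'
  have h2 := Real.mul_self_sqrt hp'.le
  have h3 := (Real.sqrt_pos.2 hp').ne'
  simp only [map_smul, smul_apply, smul_eq_mul]
  field_simp
  rw [sq, h2]

omit [FiniteDimensional ℝ F] in
-- Gram–Schmidt, with the first vector kept explicit as the normalization of `X`, so that a parallel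
-- `X` of constant length later gives a parallel first vector.
theorem IsRiemannianImmersion.exists_orthonormalFrame (h : IsRiemannianImmersion F g φ)
    (hF : Module.finrank ℝ F = 2) {p : M} {X : VField F M}
    (hX : SmoothAlongAt (F := F) (fun p : M ↦ p) X p) (hX0 : X p ≠ 0) :
    ∃ e₂ : VField F M, IsOrthonormalFrameAt (inducedMetric g φ) p
      (fun p' ↦ (Real.sqrt (inducedMetric g φ p' (X p') (X p')))⁻¹ • X p') e₂ := by
  obtain ⟨hs1, hu1⟩ := h.normalize hX hX0
  set e₁ : VField F M := fun p' ↦ (Real.sqrt (inducedMetric g φ p' (X p') (X p')))⁻¹ • X p'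
    with he₁
  obtain ⟨y, hy⟩ := exists_forall_smul_add_smul_eq_zero hF hX0
  set Y : VField F M := fun p' ↦ ofCoord p p' y
  have hY : SmoothAlongAt (F := F) (fun p : M ↦ p) Y p :=
    smoothAlongAt_ofCoord (mem_extChartAt_source p) y
  have hYp : Y p = y := by
    have := coord_ofCoord (mem_extChartAt_source (I := 𝓘(ℝ, F)) p) y
    rwa [coord_self] at this
  set Y' : VField F M := fun p' ↦
    Y p' + (-inducedMetric g φ p' (Y p') (e₁ p')) • e₁ p' with hY'
  have hY's : SmoothAlongAt (F := F) (fun p : M ↦ p) Y' p :=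
    hY.add (hs1.smul (h.contMDiffAt_induced hY hs1).neg)
  have hY'0 : Y' p ≠ 0 := by
    intro h0
    have h1 : ((-inducedMetric g φ p (Y p) (e₁ p)) *
        (Real.sqrt (inducedMetric g φ p (X p) (X p)))⁻¹) • X p + (1 : ℝ) • Y p = 0 := by
      rw [mul_smul, one_smul, add_comm]
      exact h0
    rw [hYp] at h1
    exact one_ne_zero (hy _ _ h1).2
  obtain ⟨hs2, hu2⟩ := h.normalize hY's hY'0
  refine ⟨_, hs1, hs2, hu1, hu2, ?_⟩
  filter_upwards [hu1] with p' hp'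
  have h1 : inducedMetric g φ p' (e₁ p') (Y' p') = 0 := by
    simp only [hY', map_add, map_smul, smul_eq_mul]
    rw [hp', h.induced_symm p' (e₁ p') (Y p')]
    ring
  rw [map_smul, h1, smul_zero]

omit [FiniteDimensional ℝ F] in
theorem IsRiemannianImmersion.exists_frame (h : IsRiemannianImmersion F g φ)
    (hF : Module.finrank ℝ F = 2) (p : M) :
    ∃ e₁ e₂ : VField F M, IsOrthonormalFrameAt (inducedMetric g φ) p e₁ e₂ := by
  have : Nontrivial F := Module.nontrivial_of_finrank_pos (R := ℝ) (by rw [hF]; norm_num)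
  obtain ⟨x, hx⟩ := exists_ne (0 : F)
  have hX : SmoothAlongAt (F := F) (fun p : M ↦ p) (fun p' : M ↦ ofCoord p p' x) p :=
    smoothAlongAt_ofCoord (mem_extChartAt_source p) x
  have hXp : ofCoord p p x = x := by
    have := coord_ofCoord (mem_extChartAt_source (I := 𝓘(ℝ, F)) p) x
    rwa [coord_self] at this
  obtain ⟨e₂, h2⟩ := h.exists_orthonormalFrame hF hX (by rw [hXp]; exact hx)
  exact ⟨_, e₂, h2⟩

/-- The mean curvature vector in an orthonormal basis. -/
theorem IsRiemannianImmersion.meanCurvature_eq (h : IsRiemannianImmersion F g φ)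
    (hF : Module.finrank ℝ F = 2) {p : M} {e₁ e₂ : TangentSpace 𝓘(ℝ, F) p}
    (h₁ : inducedMetric g φ p e₁ e₁ = 1) (h₂ : inducedMetric g φ p e₂ e₂ = 1)
    (h₁₂ : inducedMetric g φ p e₁ e₂ = 0) :
    meanCurvature F g φ p =
      (2⁻¹ : ℝ) • (gaussForm F g φ p e₁ e₁ + gaussForm F g φ p e₂ e₂) := by
  have hadd := gaussForm_add_left (h.regular (φ p)) (h.induced_invertible p) (h.contMDiffAt_two p)
  have hsmul := gaussForm_smul_left (h.regular (φ p)) (h.induced_invertible p)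
    (h.contMDiffAt_two p)
  have hcomm := gaussForm_comm (h.regular (φ p)) (h.induced_invertible p) (h.contMDiffAt_two p)
  have hadd' : ∀ v w w' : TangentSpace 𝓘(ℝ, F) p, gaussForm F g φ p v (w + w') =
      gaussForm F g φ p v w + gaussForm F g φ p v w' := fun v w w' ↦ by
    rw [hcomm, hadd, hcomm w, hcomm w']
  have hsmul' : ∀ (c : ℝ) (v w : TangentSpace 𝓘(ℝ, F) p), gaussForm F g φ p v (c • w) =
      c • gaussForm F g φ p v w := fun c v w ↦ by
    rw [hcomm, hsmul, hcomm w]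
  let S : F →ₗ[ℝ] F →ₗ[ℝ] E := LinearMap.mk₂ ℝ (fun v w ↦ gaussForm F g φ p v w) hadd hsmul
    hadd' hsmul'
  have key := sum_apply_inverse_coord (B := formAt (inducedMetric g φ) p) hF (h.induced_symm p)
    (h.induced_invertible p) h₁ h₂ h₁₂ S (Module.finBasis ℝ F)
  have h2 : (Module.finrank ℝ F : ℝ) = 2 := by rw [hF]; norm_num
  have hS : ∀ v w : F, secondFundamentalForm g φ p v w = S v w :=
    fun v w ↦ h.secondFundamentalForm_eq p v w
  rw [meanCurvature, h2]
  exact congrArg (fun u : E ↦ (2⁻¹ : ℝ) • u)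
    ((Finset.sum_congr rfl fun i _ ↦ hS _ _).trans key)

end Immersion

/-! ## Flatness of surfaces with a parallel vector field -/

section Flat

variable {F : Type*} [NormedAddCommGroup F] [NormedSpace ℝ F] [FiniteDimensional ℝ F]
  {M : Type*} [TopologicalSpace M] [ChartedSpace F M] [IsManifold 𝓘(ℝ, F) ∞ M]

theorem SmoothAlongAt.mlieBracket {U V : VField F M} {p : M}
    (hU : SmoothAlongAt (F := F) (fun p : M ↦ p) U p)
    (hV : SmoothAlongAt (F := F) (fun p : M ↦ p) V p) :
    SmoothAlongAt (F := F) (fun p : M ↦ p) (VectorField.mlieBracket 𝓘(ℝ, F) U V) p :=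
  have : IsManifold 𝓘(ℝ, F) (((⊤ : ℕ∞) : WithTop ℕ∞) + 1) M :=
    inferInstanceAs (IsManifold 𝓘(ℝ, F) ∞ M)
  have : IsManifold 𝓘(ℝ, F) (minSmoothness ℝ 2) M :=
    IsManifold.of_le (n := ∞) (by rw [minSmoothness_of_isRCLikeNormedField]; exact ENat.LEInfty.out)
  ContMDiffAt.mlieBracket_vectorField (m := ⊤) (n := ⊤) hU hV (by simp)

/-- The commutator of the derivations of two vector fields is the derivation of their bracket. -/
theorem mvfderiv_mlieBracket {U V : VField F M} {a : M → ℝ} {p : M} [Nontrivial F]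
    (hU : SmoothAlongAt (F := F) (fun p : M ↦ p) U p)
    (hV : SmoothAlongAt (F := F) (fun p : M ↦ p) V p)
    (ha : ContMDiffAt 𝓘(ℝ, F) 𝓘(ℝ, ℝ) ∞ a p) :
    mvfderiv 𝓘(ℝ, F) a p (VectorField.mlieBracket 𝓘(ℝ, F) U V p) =
      mvfderiv 𝓘(ℝ, F) (fun q ↦ mvfderiv 𝓘(ℝ, F) a q (V q)) p (U p)
        - mvfderiv 𝓘(ℝ, F) (fun q ↦ mvfderiv 𝓘(ℝ, F) a q (U q)) p (V p) := by
  have : IsManifold 𝓘(ℝ, F) (minSmoothness ℝ 3) M :=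
    IsManifold.of_le (n := ∞) (by rw [minSmoothness_of_isRCLikeNormedField]; exact ENat.LEInfty.out)
  have h2 : minSmoothness ℝ 2 ≤ ∞ := by
    rw [minSmoothness_of_isRCLikeNormedField]
    exact ENat.LEInfty.out
  have : IsManifold 𝓘(ℝ, F) (minSmoothness ℝ 2) M := IsManifold.of_le (n := ∞) h2
  -- The identity is extracted from the Jacobi identity: expand it for `U`, `V`, `a • W` and use the
  -- identity for `U`, `V`, `W`. The cross terms cancel, leaving the desired difference times `W`,
  -- which is nonzero at `p`.
  obtain ⟨x, hx⟩ := exists_ne (0 : F)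
  set W : VField F M := fun q ↦ ofCoord p q x with hWdef
  have hW : SmoothAlongAt (F := F) (fun p : M ↦ p) W p :=
    smoothAlongAt_ofCoord (mem_extChartAt_source p) x
  have hW0 : W p ≠ 0 := by
    have := coord_ofCoord (mem_extChartAt_source (I := 𝓘(ℝ, F)) p) x
    rw [coord_self] at this
    exact this.trans_ne hx
  have jac : ∀ {T : VField F M}, SmoothAlongAt (F := F) (fun p : M ↦ p) T p →
      VectorField.mlieBracket 𝓘(ℝ, F) U (VectorField.mlieBracket 𝓘(ℝ, F) V T) p =
      VectorField.mlieBracket 𝓘(ℝ, F) (VectorField.mlieBracket 𝓘(ℝ, F) U V) T p +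
      VectorField.mlieBracket 𝓘(ℝ, F) V (VectorField.mlieBracket 𝓘(ℝ, F) U T) p := fun hT ↦
    VectorField.leibniz_identity_mlieBracket_apply (ContMDiffAt.of_le hU h2)
      (ContMDiffAt.of_le hV h2) (ContMDiffAt.of_le hT h2)
  have hev : ∀ᶠ q in 𝓝 p, MDifferentiableAt 𝓘(ℝ, F) 𝓘(ℝ, ℝ) a q :=
    eventually_mdifferentiableAt (ha.of_le ENat.LEInfty.out)
  have step : ∀ {A B : VField F M}, SmoothAlongAt (F := F) (fun p : M ↦ p) A p →
      SmoothAlongAt (F := F) (fun p : M ↦ p) B p →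
      VectorField.mlieBracket 𝓘(ℝ, F) A (VectorField.mlieBracket 𝓘(ℝ, F) B (a • W)) p =
      (mvfderiv 𝓘(ℝ, F) (fun q ↦ mvfderiv 𝓘(ℝ, F) a q (B q)) p (A p) • W p +
        mvfderiv 𝓘(ℝ, F) a p (B p) • VectorField.mlieBracket 𝓘(ℝ, F) A W p) +
      (mvfderiv 𝓘(ℝ, F) a p (A p) • VectorField.mlieBracket 𝓘(ℝ, F) B W p +
        a p • VectorField.mlieBracket 𝓘(ℝ, F) A (VectorField.mlieBracket 𝓘(ℝ, F) B W) p) := by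
    intro A B hA hB
    have h1 : VectorField.mlieBracket 𝓘(ℝ, F) B (a • W) =ᶠ[𝓝 p]
        (fun q ↦ mvfderiv 𝓘(ℝ, F) a q (B q)) • W + a • VectorField.mlieBracket 𝓘(ℝ, F) B W := by
      filter_upwards [hev, hW.eventually] with q h2 h3
      exact VectorField.mlieBracket_smul_right h2 h3
    have hBW := hB.mlieBracket hW
    have hda := contMDiffAt_mvfderiv ha hB
    have d1 : DiffAlongAt (F := F) (fun p : M ↦ p) ((fun q ↦ mvfderiv 𝓘(ℝ, F) a q (B q)) • W) p :=
      (SmoothAlongAt.smul hda hW).diffAlongAt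
    have d2 : DiffAlongAt (F := F) (fun p : M ↦ p)
        (a • VectorField.mlieBracket 𝓘(ℝ, F) B W) p := (SmoothAlongAt.smul ha hBW).diffAlongAt
    rw [Filter.EventuallyEq.mlieBracket_vectorField_eq (Filter.EventuallyEq.refl _ A) h1,
      VectorField.mlieBracket_add_right d1 d2,
      VectorField.mlieBracket_smul_right (hda.mdifferentiableAt (by simp)) hW.diffAlongAt,
      VectorField.mlieBracket_smul_right (ha.mdifferentiableAt (by simp)) hBW.diffAlongAt]
  have j1 := jac (T := a • W) (hW.smul ha)
  have j2 := jac hW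
  rw [step hU hV, step hV hU, j2,
    VectorField.mlieBracket_smul_right (ha.mdifferentiableAt (by simp)) hW.diffAlongAt] at j1
  have h0 : (mvfderiv 𝓘(ℝ, F) a p (VectorField.mlieBracket 𝓘(ℝ, F) U V p) -
      (mvfderiv 𝓘(ℝ, F) (fun q ↦ mvfderiv 𝓘(ℝ, F) a q (V q)) p (U p)
        - mvfderiv 𝓘(ℝ, F) (fun q ↦ mvfderiv 𝓘(ℝ, F) a q (U q)) p (V p))) • W p = 0 := by
    rw [sub_smul, sub_smul]
    rw [smul_add] at j1
    rw [← sub_eq_zero] at j1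
    rw [← neg_eq_zero, ← j1]
    abel
  exact sub_eq_zero.1 ((smul_eq_zero.1 h0).resolve_right hW0)

variable {E : Type*} [NormedAddCommGroup E] [NormedSpace ℝ E]
  {N : Type*} [TopologicalSpace N] [ChartedSpace E N] [IsManifold 𝓘(ℝ, E) ∞ N]
  {g : FormField E N} {φ : M → N} {p : M} {e₁ e₂ : VField F M}

namespace IsRiemannianImmersion

/-- The derivative of a combination of parallel vector fields. -/
theorem leviCivita_parallel_combination (h : IsRiemannianImmersion F g φ)
    (d₁ : DiffAlongAt (F := F) (fun p : M ↦ p) e₁ p)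
    (d₂ : DiffAlongAt (F := F) (fun p : M ↦ p) e₂ p)
    (h₁ : ∀ v, leviCivita (inducedMetric g φ) e₁ p v = 0)
    (h₂ : ∀ v, leviCivita (inducedMetric g φ) e₂ p v = 0) {a b : M → ℝ}
    (ha : MDifferentiableAt 𝓘(ℝ, F) 𝓘(ℝ, ℝ) a p) (hb : MDifferentiableAt 𝓘(ℝ, F) 𝓘(ℝ, ℝ) b p)
    {Z : VField F M} (hZ : ∀ᶠ q in 𝓝 p, Z q = a q • e₁ q + b q • e₂ q)
    (v : TangentSpace 𝓘(ℝ, F) p) :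
    leviCivita (inducedMetric g φ) Z p v =
      mvfderiv 𝓘(ℝ, F) a p v • e₁ p + mvfderiv 𝓘(ℝ, F) b p v • e₂ p := by
  have hr := h.induced_regular p
  have k1 := covAlong_smul (φ := fun p : M ↦ p) hr ha d₁ v
  have k2 := covAlong_smul (φ := fun p : M ↦ p) hr hb d₂ v
  have k3 := covAlong_add (φ := fun p : M ↦ p) hr (d₁.smul ha) (d₂.smul hb) v
  have h₁v := h₁ v
  have h₂v := h₂ v
  rw [leviCivita] at h₁v h₂v ⊢
  rw [covAlong_congr hZ, k3, k1, k2, h₁v, h₂v, smul_zero, smul_zero, zero_add, zero_add]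

theorem eventually_eq_add (h : IsRiemannianImmersion F g φ) (hF : Module.finrank ℝ F = 2)
    (he : IsOrthonormalFrameAt (inducedMetric g φ) p e₁ e₂) :
    ∀ᶠ q in 𝓝 p, ∀ w : TangentSpace 𝓘(ℝ, F) q,
      w = inducedMetric g φ q w (e₁ q) • e₁ q + inducedMetric g φ q w (e₂ q) • e₂ q := by
  filter_upwards [he.unit₁, he.unit₂, he.orthogonal] with q h₁ h₂ h₁₂
  exact eq_add_of_orthonormal (B := formAt (inducedMetric (F := F) g φ) q) hF (h.induced_symm q)
    h₁ h₂ h₁₂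

/-- Differentiating `⟨e₂, e₁⟩ = 0` and `⟨e₂, e₂⟩ = 1` shows that the derivative of `e₂` is
orthogonal to both frame vectors. -/
theorem parallel_of_orthonormal (h : IsRiemannianImmersion F g φ) (hF : Module.finrank ℝ F = 2)
    (he : IsOrthonormalFrameAt (inducedMetric g φ) p e₁ e₂)
    (h₁ : ∀ᶠ q in 𝓝 p, ∀ v, leviCivita (inducedMetric g φ) e₁ q v = 0) :
    ∀ᶠ q in 𝓝 p, ∀ v, leviCivita (inducedMetric g φ) e₂ q v = 0 := by
  filter_upwards [h₁, h.eventually_eq_add hF he, he.smooth₁.eventually, he.smooth₂.eventually,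
    he.orthogonal.eventually_nhds, he.unit₂.eventually_nhds] with q hq heq d₁ d₂ ho hu v
  have k1 := h.mvfderiv_induced d₂ d₁ v
  have k2 := h.mvfderiv_induced d₂ d₂ v
  have c1 : mvfderiv 𝓘(ℝ, F) (fun p' ↦ inducedMetric g φ p' (e₂ p') (e₁ p')) q v = 0 := by
    have : (fun p' ↦ inducedMetric g φ p' (e₂ p') (e₁ p')) =ᶠ[𝓝 q] fun _ ↦ (0 : ℝ) :=
      ho.mono fun q' hq' ↦ (h.induced_symm q' _ _).trans hq'
    exact congrArg (fun L : F →L[ℝ] ℝ ↦ L v) (this.mfderiv_eq.trans (mfderiv_const ..))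
  have c2 : mvfderiv 𝓘(ℝ, F) (fun p' ↦ inducedMetric g φ p' (e₂ p') (e₂ p')) q v = 0 := by
    have : (fun p' ↦ inducedMetric g φ p' (e₂ p') (e₂ p')) =ᶠ[𝓝 q] fun _ ↦ (1 : ℝ) := hu
    exact congrArg (fun L : F →L[ℝ] ℝ ↦ L v) (this.mfderiv_eq.trans (mfderiv_const ..))
  rw [c1, hq, map_zero, add_zero] at k1
  rw [c2, h.induced_symm q (e₂ q)] at k2
  have k3 : inducedMetric g φ q (leviCivita (inducedMetric g φ) e₂ q v) (e₂ q) = 0 := by linarith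
  have k4 := heq (leviCivita (inducedMetric g φ) e₂ q v)
  rwa [← k1, k3, zero_smul, zero_smul, add_zero] at k4

/-- A surface with a parallel orthonormal frame is flat. -/
theorem curvature_eq_zero (h : IsRiemannianImmersion F g φ) (hF : Module.finrank ℝ F = 2)
    (he : IsOrthonormalFrameAt (inducedMetric g φ) p e₁ e₂)
    (h₁ : ∀ᶠ q in 𝓝 p, ∀ v, leviCivita (inducedMetric g φ) e₁ q v = 0) {X Y Z : VField F M}
    (hX : SmoothAlongAt (F := F) (fun p : M ↦ p) X p)
    (hY : SmoothAlongAt (F := F) (fun p : M ↦ p) Y p)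
    (hZ : SmoothAlongAt (F := F) (fun p : M ↦ p) Z p) :
    curvature (inducedMetric g φ) X Y Z p = 0 := by
  have : Nontrivial F := Module.nontrivial_of_finrank_pos (R := ℝ) (by rw [hF]; norm_num)
  have h₂ := h.parallel_of_orthonormal hF he h₁
  set a : M → ℝ := fun q ↦ inducedMetric g φ q (Z q) (e₁ q)
  set b : M → ℝ := fun q ↦ inducedMetric g φ q (Z q) (e₂ q)
  have ha : ContMDiffAt 𝓘(ℝ, F) 𝓘(ℝ, ℝ) ∞ a p := h.contMDiffAt_induced hZ he.smooth₁
  have hb : ContMDiffAt 𝓘(ℝ, F) 𝓘(ℝ, ℝ) ∞ b p := h.contMDiffAt_induced hZ he.smooth₂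
  have hZe : ∀ᶠ q in 𝓝 p, Z q = a q • e₁ q + b q • e₂ q :=
    (h.eventually_eq_add hF he).mono fun q hq ↦ hq (Z q)
  have hderiv : ∀ᶠ q in 𝓝 p, ∀ v, leviCivita (inducedMetric g φ) Z q v =
      mvfderiv 𝓘(ℝ, F) a q v • e₁ q + mvfderiv 𝓘(ℝ, F) b q v • e₂ q := by
    filter_upwards [h₁, h₂, he.smooth₁.eventually, he.smooth₂.eventually, hZe.eventually_nhds,
      eventually_mdifferentiableAt (ha.of_le ENat.LEInfty.out),
      eventually_mdifferentiableAt (hb.of_le ENat.LEInfty.out)] with q k1 k2 k3 k3' k4 k5 k6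
    exact h.leviCivita_parallel_combination k3 k3' k1 k2 k5 k6 k4
  -- In a parallel frame covariant differentiation acts on the coefficients alone, so each component
  -- of the curvature is `X(Y a) - Y(X a) - [X, Y] a = 0`.
  have hsecond : ∀ {U : VField F M}, SmoothAlongAt (F := F) (fun p : M ↦ p) U p →
      ∀ v, leviCivita (inducedMetric g φ)
        (fun q ↦ leviCivita (inducedMetric g φ) Z q (U q)) p v =
      mvfderiv 𝓘(ℝ, F) (fun q ↦ mvfderiv 𝓘(ℝ, F) a q (U q)) p v • e₁ p +
        mvfderiv 𝓘(ℝ, F) (fun q ↦ mvfderiv 𝓘(ℝ, F) b q (U q)) p v • e₂ p := fun hU ↦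
    h.leviCivita_parallel_combination he.smooth₁.diffAlongAt he.smooth₂.diffAlongAt
      h₁.self_of_nhds h₂.self_of_nhds
      ((contMDiffAt_mvfderiv ha hU).mdifferentiableAt (by simp))
      ((contMDiffAt_mvfderiv hb hU).mdifferentiableAt (by simp))
      (hderiv.mono fun q hq ↦ hq _)
  rw [curvature, hsecond hX, hsecond hY, hderiv.self_of_nhds, mvfderiv_mlieBracket hX hY ha,
    mvfderiv_mlieBracket hX hY hb]
  module

end IsRiemannianImmersion

end Flat

/-! ### Parallel vector fields on connected surfaces -/

section ParallelField

variable {E : Type*} [NormedAddCommGroup E] [NormedSpace ℝ E]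
  {N : Type*} [TopologicalSpace N] [ChartedSpace E N] [IsManifold 𝓘(ℝ, E) ∞ N]
  {F : Type*} [NormedAddCommGroup F] [NormedSpace ℝ F]
  {M : Type*} [TopologicalSpace M] [ChartedSpace F M] [IsManifold 𝓘(ℝ, F) ∞ M]

theorem isLocallyConstant_of_mvfderiv_eq_zero {f : M → ℝ}
    (hf : ∀ p, MDifferentiableAt 𝓘(ℝ, F) 𝓘(ℝ, ℝ) f p)
    (h0 : ∀ p v, mvfderiv 𝓘(ℝ, F) f p v = 0) : IsLocallyConstant f := by
  rw [IsLocallyConstant.iff_eventually_eq]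
  intro p
  set ψ := extChartAt 𝓘(ℝ, F) p with hψ
  obtain ⟨r, hr, hball⟩ := Metric.mem_nhds_iff.1 (extChartAt_target_mem_nhds (I := 𝓘(ℝ, F)) p)
  have hd : ∀ y ∈ Metric.ball (ψ p) r, HasFDerivAt (fun y ↦ f (ψ.symm y)) (0 : F →L[ℝ] ℝ) y := by
    intro y hy
    have hsm : ContMDiffAt 𝓘(ℝ, F) 𝓘(ℝ, F) ∞ ψ.symm y :=
      (contMDiffOn_extChartAt_symm p).contMDiffAt (extChartAt_target_mem_nhds' (hball hy))
    have h1 := HasMFDerivAt.comp (g := f) (f := ψ.symm) y (hf _).hasMFDerivAt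
      (hsm.mdifferentiableAt (by simp)).hasMFDerivAt
    have h2 : (mfderiv 𝓘(ℝ, F) 𝓘(ℝ, ℝ) f (ψ.symm y)).comp (mfderiv 𝓘(ℝ, F) 𝓘(ℝ, F) ψ.symm y) =
        0 := by
      ext v
      exact h0 _ _
    rw [h2] at h1
    exact h1.hasFDerivAt
  have hc : ∀ y ∈ Metric.ball (ψ p) r, f (ψ.symm y) = f (ψ.symm (ψ p)) := fun y hy ↦
    (convex_ball (ψ p) r).is_const_of_fderivWithin_eq_zero (𝕜 := ℝ)
      (f := fun y ↦ f (ψ.symm y))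
      (fun z hz ↦ (hd z hz).differentiableAt.differentiableWithinAt)
      (fun z hz ↦ (hd z hz).hasFDerivWithinAt.fderivWithin
        (Metric.isOpen_ball.uniqueDiffWithinAt hz)) hy (Metric.mem_ball_self hr)
  filter_upwards [extChartAt_source_mem_nhds (I := 𝓘(ℝ, F)) p,
    (continuousAt_extChartAt (I := 𝓘(ℝ, F)) p).preimage_mem_nhds (Metric.ball_mem_nhds _ hr)]
    with q h1 h2
  have := hc _ h2
  rwa [ψ.left_inv h1, ψ.left_inv (mem_extChartAt_source p)] at this

/-- A connected surface with a nonzero parallel vector field is flat. -/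
theorem IsRiemannianImmersion.isFlat_or_eq_zero [FiniteDimensional ℝ F] [ConnectedSpace M]
    {g : FormField E N} {φ : M → N} (h : IsRiemannianImmersion F g φ)
    (hF : Module.finrank ℝ F = 2) {X : VField F M}
    (hX : ∀ p, SmoothAlongAt (F := F) (fun p : M ↦ p) X p)
    (hpar : ∀ p v, leviCivita (inducedMetric g φ) X p v = 0) :
    IsFlat (inducedMetric (F := F) g φ) ∨ ∀ p, X p = 0 := by
  set f : M → ℝ := fun p ↦ inducedMetric g φ p (X p) (X p) with hf
  have hconst : ∀ p q, f p = f q := by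
    refine fun p q ↦ (isLocallyConstant_of_mvfderiv_eq_zero (F := F)
      (fun p ↦ (h.contMDiffAt_induced (hX p) (hX p)).mdifferentiableAt (by simp))
      fun p v ↦ ?_).apply_eq_of_isPreconnected isPreconnected_univ (mem_univ p) (mem_univ q)
    rw [h.mvfderiv_induced (hX p).diffAlongAt (hX p).diffAlongAt, hpar, map_zero, map_zero,
      zero_apply, add_zero]
  by_cases h0 : ∃ p, X p = 0
  · obtain ⟨p, hp⟩ := h0
    refine Or.inr fun q ↦ ?_
    by_contra hq
    refine (h.induced_pos q _ hq).ne' ((hconst q p).trans ?_)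
    rw [hf]
    simp only [hp, map_zero]
  · push Not at h0
    refine Or.inl fun U V W hU hV hW p ↦ ?_
    -- The first frame vector is `X / |X|`. As `|X|` is constant, the factor can be replaced by its
    -- value at `p`, so this vector is again parallel.
    obtain ⟨e₂, he⟩ := h.exists_orthonormalFrame hF (hX p) (h0 p)
    refine h.curvature_eq_zero hF he (Filter.Eventually.of_forall fun q v ↦ ?_) (hU p) (hV p) (hW p)
    have h1 := covAlong_smul (φ := fun p : M ↦ p) (h.induced_regular q)
      (mdifferentiableAt_const (c := (Real.sqrt (f p))⁻¹)) (hX q).diffAlongAt v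
    have h2 : mvfderiv 𝓘(ℝ, F) (fun _ : M ↦ (Real.sqrt (f p))⁻¹) q v = 0 :=
      congrArg (fun L : F →L[ℝ] ℝ ↦ L v) (mfderiv_const ..)
    have h3 : covAlong (inducedMetric g φ) (fun p : M ↦ p) X q v = 0 := hpar q v
    rw [h2, h3, smul_zero, zero_smul, add_zero] at h1
    refine (covAlong_congr (Filter.Eventually.of_forall fun q' ↦ ?_) v).trans h1
    rw [hconst p q']

end ParallelField

/-! ## Totally real surfaces with parallel `f`-structure -/

namespace KahlerStructure

variable {E : Type*} [NormedAddCommGroup E] [NormedSpace ℝ E]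
  {N : Type*} [TopologicalSpace N] [ChartedSpace E N] [IsManifold 𝓘(ℝ, E) ∞ N]
  (K : KahlerStructure E N)
  {F : Type*} [NormedAddCommGroup F] [NormedSpace ℝ F]
  {M : Type*} [TopologicalSpace M] [ChartedSpace F M] {φ : M → N}

theorem isRiemannianImmersion [FiniteDimensional ℝ E] (hφ : IsSmoothImmersion E F φ) :
    IsRiemannianImmersion F K.g φ where
  smooth := K.metric.contMDiff
  regular := isRegularAt_of_smooth K.metric.contMDiff K.metric.symm K.metric.pos
  pos := K.metric.pos
  immersion := hφ

theorem smoothAlongAt_J {s : ∀ p : M, TangentSpace 𝓘(ℝ, E) (φ p)} {p : M}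
    (hs : SmoothAlongAt (F := F) φ s p) :
    SmoothAlongAt (F := F) φ (fun p' ↦ K.J (φ p') (s p')) p :=
  ContMDiffAt.clm_bundle_apply (ContMDiffAt.comp p (K.smooth_J (φ p)) hs.contMDiffAt) hs

theorem covAlong_J [FiniteDimensional ℝ E] [T2Space N] {s : ∀ p : M, TangentSpace 𝓘(ℝ, E) (φ p)}
    {p : M} (hs : DiffAlongAt (F := F) φ s p) (v : TangentSpace 𝓘(ℝ, F) p) :
    covAlong K.g φ (fun p' ↦ K.J (φ p') (s p')) p v = K.J (φ p) (covAlong K.g φ s p v) :=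
  (covAlong_endomorphism (fun _ hX ↦ ContMDiff.clm_bundle_apply K.smooth_J hX) K.parallel_J
    (isRegularAt_of_smooth K.metric.contMDiff K.metric.symm K.metric.pos _) hs).2 v

theorem metric_J_left (q : N) (v w : TangentSpace 𝓘(ℝ, E) q) :
    K.g q (K.J q v) w = -K.g q v (K.J q w) := by
  rw [← K.metric_J q v, K.J_J, map_neg, neg_neg]

variable [FiniteDimensional ℝ E] [T2Space N] [FiniteDimensional ℝ F] [T2Space M]
  [IsManifold 𝓘(ℝ, F) ∞ M]

/-- If `f` is parallel, `J` maps the second fundamental form to tangent vectors. -/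
theorem J_gaussForm (hφ : IsSmoothImmersion E F φ) (hreal : K.IsTotallyReal F φ)
    (hf : K.HasParallelF F φ) (p : M) (v z : TangentSpace 𝓘(ℝ, F) p) :
    K.J (φ p) (gaussForm F K.g φ p v z) =
      differential E F φ p (tangentPart F K.g φ p (K.J (φ p) (gaussForm F K.g φ p v z))) := by
  have h := K.isRiemannianImmersion hφ
  -- The hypothesis on `f` speaks of globally defined normal fields, so `z` is extended to all of
  -- `M`.
  obtain ⟨Z, hZ, hZe⟩ := exists_smoothField (E := F) p z
  have hZp : Z p = z := by
    have := coord_ofCoord (mem_extChartAt_source (I := 𝓘(ℝ, F)) p) z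
    rw [coord_self] at this
    exact hZe.self_of_nhds.trans this
  set ξ : ∀ p : M, TangentSpace 𝓘(ℝ, E) (φ p) :=
    fun p' ↦ K.J (φ p') (differential E F φ p' (Z p')) with hξ
  have hdZ : ∀ p', SmoothAlongAt (F := F) φ (fun p' ↦ differential E F φ p' (Z p')) p' := fun p' ↦
    smoothAlongAt_differential (hφ.1 p') (hZ p')
  have hnormal : IsNormalField F K.g φ ξ :=
    ⟨fun p' ↦ K.smoothAlongAt_J (hdZ p'), fun p' w ↦ hreal p' (Z p') w⟩
  -- `J ξ = -dφ(Z)` is tangent.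
  have hfξ : (fun p' ↦ K.f F φ p' (ξ p')) = fun p' ↦ (0 : TangentSpace 𝓘(ℝ, E) (φ p')) := by
    funext p'
    refine h.normalPart_eq (t := -Z p') ?_ fun w ↦ by rw [map_zero, zero_apply]
    rw [K.J_J, add_zero, map_neg]
  have hzero : normalCov K.g φ (fun p' ↦ K.f F φ p' (ξ p')) p v = 0 := by
    rw [hfξ, normalCov, covAlong_zero (h.regular _) ((hφ.1 p).mdifferentiableAt (by simp))]
    exact h.normalPart_eq (t := 0) (by rw [map_zero, add_zero]) fun w ↦ by
      rw [map_zero, zero_apply]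
  set σ := gaussForm F K.g φ p v z with hσ
  set t := tangentPart F K.g φ p (K.J (φ p) σ) with ht
  set n := normalPart F K.g φ p (K.J (φ p) σ) with hn
  have hJσ : K.J (φ p) σ = differential E F φ p t + n := by
    rw [hn, normalPart, add_sub_cancel]
  set u := leviCivita (inducedMetric K.g φ) Z p v
  have hcov : covAlong K.g φ ξ p v =
      differential E F φ p t + (K.J (φ p) (differential E F φ p u) + n) := by
    rw [hξ, K.covAlong_J (hdZ p).diffAlongAt, h.gauss_formula (SmoothAlongAt.diffAlongAt (hZ p)),
      hZp, map_add, hJσ]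
    abel
  have hD : normalCov K.g φ ξ p v = K.J (φ p) (differential E F φ p u) + n := by
    refine h.normalPart_eq hcov fun w ↦ ?_
    rw [map_add, add_apply, hreal, zero_add]
    exact h.metric_normalPart p _ w
  have hJn : K.J (φ p) n = -σ - K.J (φ p) (differential E F φ p t) := by
    rw [← K.J_J, ← map_sub, hJσ, add_sub_cancel_left]
  -- `J` sends `J dφ(u)` to a tangent vector, while `J n = -σ - J dφ(t)` is already normal; so `f
  -- (D_v ξ)` is all of `J n`.
  have hfD : K.f F φ p (normalCov K.g φ ξ p v) =
      -σ - K.J (φ p) (differential E F φ p t) := by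
    rw [hD]
    refine h.normalPart_eq (t := -u) ?_ fun w ↦ ?_
    · rw [map_add, K.J_J, hJn, map_neg]
    · rw [map_sub, map_neg, sub_apply, neg_apply, hreal, h.metric_gaussForm, neg_zero, sub_zero]
  have hfin := hf ξ hnormal p v
  rw [hzero, hfD] at hfin
  have h1 : K.J (φ p) n = 0 := hJn.trans hfin.symm
  have h2 : n = 0 := by
    rw [← neg_eq_zero, ← K.J_J, h1, map_zero]
  rw [hJσ, h2, add_zero]

/-- `H = J dφ(h)` with `h` the tangential part of `-J H`. -/
theorem J_differential_tangentPart_meanCurvature (hF : Module.finrank ℝ F = 2)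
    (hφ : IsSmoothImmersion E F φ) (hreal : K.IsTotallyReal F φ) (hf : K.HasParallelF F φ) (p : M) :
    K.J (φ p) (differential E F φ p
      (tangentPart F K.g φ p (-K.J (φ p) (meanCurvature F K.g φ p)))) =
      meanCurvature F K.g φ p := by
  have h := K.isRiemannianImmersion hφ
  obtain ⟨e₁, e₂, he⟩ := h.exists_frame hF p
  have hH := h.meanCurvature_eq hF he.unit₁.self_of_nhds he.unit₂.self_of_nhds
    he.orthogonal.self_of_nhds
  -- `H` is half a sum of values of `σ`, and `J` makes each of them tangent.
  have h1 : ∃ t, -K.J (φ p) (meanCurvature F K.g φ p) = differential E F φ p t := by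
    rw [hH, map_smul, map_add, K.J_gaussForm hφ hreal hf, K.J_gaussForm hφ hreal hf p (e₂ p),
      ← map_add, ← map_smul, ← map_neg]
    exact ⟨_, rfl⟩
  obtain ⟨t, ht⟩ := h1
  have h2 : tangentPart F K.g φ p (-K.J (φ p) (meanCurvature F K.g φ p)) = t :=
    h.tangentPart_eq (n := 0) (by rw [ht, add_zero]) fun w ↦ by rw [map_zero, zero_apply]
  rw [h2, ← ht, map_neg, K.J_J, neg_neg]

omit [T2Space N] [T2Space M] in
-- In a local orthonormal frame the component of the field along `e` is `g(H, J e)`. The tangential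
-- part of the ambient derivative of `e_i` along itself is orthogonal to `J e`, as `M` is totally
-- real, so the component is half the sum of the pairings of these full ambient derivatives with `J
-- e`, each smooth by `contMDiffAt_metric_covAlong`.
theorem smoothAlongAt_tangentPart_meanCurvature (hF : Module.finrank ℝ F = 2)
    (hφ : IsSmoothImmersion E F φ) (hreal : K.IsTotallyReal F φ) (p : M) :
    SmoothAlongAt (F := F) (fun p : M ↦ p)
      (fun p' ↦ tangentPart F K.g φ p' (-K.J (φ p') (meanCurvature F K.g φ p'))) p := by
  have h := K.isRiemannianImmersion hφ
  obtain ⟨e₁, e₂, he⟩ := h.exists_frame hF p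
  set X : VField F M := fun p' ↦ tangentPart F K.g φ p' (-K.J (φ p') (meanCurvature F K.g φ p'))
    with hX
  have key : ∀ {e : VField F M}, SmoothAlongAt (F := F) (fun p : M ↦ p) e p →
      ContMDiffAt 𝓘(ℝ, F) 𝓘(ℝ, ℝ) ∞ (fun q ↦ inducedMetric K.g φ q (X q) (e q)) p := by
    intro e hes
    have hc : ∀ {a : VField F M}, SmoothAlongAt (F := F) (fun p : M ↦ p) a p →
        ContMDiffAt 𝓘(ℝ, F) 𝓘(ℝ, ℝ) ∞ (fun q ↦ K.g (φ q)
          (covAlong K.g φ (fun q' ↦ differential E F φ q' (a q')) q (a q))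
          (K.J (φ q) (differential E F φ q (e q)))) p := fun ha ↦
      contMDiffAt_metric_covAlong h.smooth K.metric.symm K.metric.pos ha
        (smoothAlongAt_differential (hφ.1 p) ha)
        (K.smoothAlongAt_J (smoothAlongAt_differential (hφ.1 p) hes))
    refine ((contMDiffAt_const (c := (2⁻¹ : ℝ))).mul
      ((hc he.smooth₁).add (hc he.smooth₂))).congr_of_eventuallyEq ?_
    filter_upwards [he.smooth₁.eventually, he.smooth₂.eventually, he.unit₁, he.unit₂,
      he.orthogonal] with q d₁ d₂ u₁ u₂ o
    have ho : ∀ u w, K.g (φ q) (differential E F φ q u) (K.J (φ q) (differential E F φ q w)) = 0 :=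
      fun u w ↦ (K.metric.symm _ _ _).trans (hreal q w u)
    rw [hX]
    simp only [Pi.mul_apply, Pi.add_apply]
    rw [h.metric_tangentPart, map_neg, neg_apply, K.metric_J_left, neg_neg,
      h.meanCurvature_eq hF u₁ u₂ o, h.gauss_formula d₁, h.gauss_formula d₂, map_smul, smul_apply,
      map_add, map_add, map_add, add_apply, add_apply, add_apply, ho, ho, zero_add, zero_add,
      smul_eq_mul]
  refine ((he.smooth₁.smul (key he.smooth₁)).add (he.smooth₂.smul (key he.smooth₂))).congr ?_
  exact (h.eventually_eq_add hF he).mono fun q hq ↦ hq (X q)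

/-- Differentiating `H = J dφ(X)` splits into the normal vector `J dφ(∇_v X)` and the tangent vector
`J σ(v, X)`. The normal one is `D_v H = 0`, and both `J` and `dφ` are injective. -/
theorem parallel_tangentPart_meanCurvature (hF : Module.finrank ℝ F = 2)
    (hφ : IsSmoothImmersion E F φ) (hreal : K.IsTotallyReal F φ) (hf : K.HasParallelF F φ)
    (hH : IsNormalParallel F K.g φ (meanCurvature F K.g φ)) (p : M) (v : TangentSpace 𝓘(ℝ, F) p) :
    leviCivita (inducedMetric K.g φ)
      (fun p' ↦ tangentPart F K.g φ p' (-K.J (φ p') (meanCurvature F K.g φ p'))) p v = 0 := by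
  have h := K.isRiemannianImmersion hφ
  have hs := K.smoothAlongAt_tangentPart_meanCurvature hF hφ hreal p
  have hJ := K.J_differential_tangentPart_meanCurvature hF hφ hreal hf
  set X : VField F M := fun p' ↦ tangentPart F K.g φ p' (-K.J (φ p') (meanCurvature F K.g φ p'))
  set u := leviCivita (inducedMetric K.g φ) X p v
  have hcov : covAlong K.g φ (meanCurvature F K.g φ) p v =
      differential E F φ p (tangentPart F K.g φ p (K.J (φ p) (gaussForm F K.g φ p v (X p))))
        + K.J (φ p) (differential E F φ p u) := by
    have h1 : meanCurvature F K.g φ = fun p' ↦ K.J (φ p') (differential E F φ p' (X p')) :=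
      funext fun p' ↦ (hJ p').symm
    rw [h1, K.covAlong_J (smoothAlongAt_differential (hφ.1 p) hs).diffAlongAt,
      h.gauss_formula hs.diffAlongAt, map_add, ← K.J_gaussForm hφ hreal hf, add_comm]
  have h2 : K.J (φ p) (differential E F φ p u) = 0 :=
    (h.normalPart_eq hcov fun w ↦ hreal p u w).symm.trans (hH p v)
  refine hφ.2 p ?_
  rw [map_zero, ← neg_eq_zero, ← K.J_J, h2, map_zero]

/-- A totally real connected surface with parallel `f`-structure and parallel mean curvature vector
is flat or minimal. -/
theorem isFlat_or_isMinimal [ConnectedSpace M] (hF : Module.finrank ℝ F = 2)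
    (hφ : IsSmoothImmersion E F φ) (hreal : K.IsTotallyReal F φ) (hf : K.HasParallelF F φ)
    (hH : IsNormalParallel F K.g φ (meanCurvature F K.g φ)) :
    IsFlat (inducedMetric (F := F) K.g φ) ∨ IsMinimal F K.g φ := by
  refine ((K.isRiemannianImmersion hφ).isFlat_or_eq_zero hF
    (K.smoothAlongAt_tangentPart_meanCurvature hF hφ hreal)
    (K.parallel_tangentPart_meanCurvature hF hφ hreal hf hH)).imp_right fun h0 p ↦ ?_
  rw [← K.J_differential_tangentPart_meanCurvature hF hφ hreal hf, h0 p, map_zero, map_zero]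

end KahlerStructure

end TotallyReal

end

theorem proposition5 {m : ℕ}
    {N : Type*} [TopologicalSpace N] [T2Space N]
    [ChartedSpace (EuclideanSpace ℝ (Fin (2 * m))) N]
    [IsManifold 𝓘(ℝ, EuclideanSpace ℝ (Fin (2 * m))) ∞ N]
    (K : TotallyReal.KahlerStructure (EuclideanSpace ℝ (Fin (2 * m))) N)
    {M : Type*} [TopologicalSpace M] [T2Space M] [ConnectedSpace M]
    [ChartedSpace (EuclideanSpace ℝ (Fin 2)) M]
    [IsManifold 𝓘(ℝ, EuclideanSpace ℝ (Fin 2)) ∞ M]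
    (φ : M → N)
    (hφ : TotallyReal.IsSmoothImmersion
      (EuclideanSpace ℝ (Fin (2 * m))) (EuclideanSpace ℝ (Fin 2)) φ)
    (hreal : K.IsTotallyReal (EuclideanSpace ℝ (Fin 2)) φ)
    (hf : K.HasParallelF (EuclideanSpace ℝ (Fin 2)) φ)
    (hH : TotallyReal.IsNormalParallel (EuclideanSpace ℝ (Fin 2)) K.g φ
      (TotallyReal.meanCurvature (EuclideanSpace ℝ (Fin 2)) K.g φ)) :
    TotallyReal.IsFlat
        (TotallyReal.inducedMetric (F := EuclideanSpace ℝ (Fin 2)) K.g φ) ∨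
      TotallyReal.IsMinimal (EuclideanSpace ℝ (Fin 2)) K.g φ := by
  exact K.isFlat_or_isMinimal (by simp) hφ hreal hf hH
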